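/- Let $K\ge 2$ be an integer and let $X$ be a regular $K$-ary tree, i.e. a rooted tree with root $0$ in which every vertex has exactly $K$ children, regarded as a metric graph with edges of length one; let $|x|$ be the distance from $0$ to $x\in X$ and $d|x|$ the length measure. Fix $\varepsilon>0$, $\beta>\log K$ and $1\le p<\infty$, and equip $X$ with the metric $d_X(x,y)=\int_{[x,y]}e^{-\varepsilon|z|}\,d|z|$, where $[x,y]$ is the geodesic from $x$ to $y$, and with the measure $d\mu(x)=e^{-\beta|x|}\,d|x|$. A Borel function $g:X\to[0,\infty]$ is an upper gradient of $f:X\to\mathbb R$ if $|f(x)-f(y)|\le\int_{[x,y]}g(z)\,e^{-\varepsilon|z|}\,d|z|$ for all $x,y\in X$; the space $N^{1,p}(X)$ consists of all (measurable) $f:X\to\mathbb R$ with $$\|f\|_{N^{1,p}(X)}=\Bigl(\int_X|f|^p\,d\mu+\inf_g\int_X g^p\,d\mu\Bigr)^{1/p}<\infty,$$ the infimum being over all upper gradients $g$ of $f$. The boundary $\partial X$ is the set of infinite geodesics starting at $0$, with the metric $d_X(\zeta,\xi)=\frac2\varepsilon e^{-\varepsilon k}$ for $\zeta\ne\xi$,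 where $k$ is the level of the last common vertex of $\zeta$ and $\xi$. Let $\nu$ be the Hausdorff measure of dimension $(\log K)/\varepsilon$ on $\partial X$, normalized to total mass $1$. For $\theta>0$, $B^\theta_{p,p}(\partial X)$ is the space of all $u\in L^p(\partial X,\nu)$ with $$\|u\|_{B^\theta_{p,p}(\partial X)}=\Bigl(\int_0^\infty t^{-\theta p}\int_{\partial X}\frac1{\nu(B(\zeta,t))}\int_{B(\zeta,t)}|u(\zeta)-u(\xi)|^p\,d\nu(\xi)\,d\nu(\zeta)\,\frac{dt}t\Bigr)^{1/p}<\infty,$$ where $B(\zeta,t)$ is the open ball in $\partial X$, and it is normed by $\|u\|_{L^p(\partial X)}+\|u\|_{B^\theta_{p,p}(\partial X)}$. A function $u:\partial X\to\mathbb R$ is the trace of $f:X\to\mathbb R$, written $u=\operatorname{Tr}f$, if for $\nu$-a.e. $\zeta\in\partial X$ the limit of $f(x)$ as $x\to\zeta$ along the geodesic ray $[0,\zeta)$ exists and equals $u(\zeta)$. Theorem. Assume that $\theta:=1-\dfrac{\beta-\log K}{p\varepsilon}>0$. Then every $f\in N^{1,p}(X)$ has a trace, and the trace space $\{\operatorname{Tr}f:f\in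 N^{1,p}(X)\}$ is exactly $B^\theta_{p,p}(\partial X)$, with equivalent norms: there is a constant $C$ such that, for every $u\in B^\theta_{p,p}(\partial X)$, $$\frac1C\bigl(\|u\|_{L^p(\partial X)}+\|u\|_{B^\theta_{p,p}(\partial X)}\bigr)\le\inf\{\|f\|_{N^{1,p}(X)}:f\in N^{1,p}(X),\ \operatorname{Tr}f=u\}\le C\bigl(\|u\|_{L^p(\partial X)}+\|u\|_{B^\theta_{p,p}(\partial X)}\bigr).$$ -/

import Mathlib

open Set Filter Topology MeasureTheory
open scoped NNReal ENNReal

noncomputable section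

namespace KTree

variable {V : Type*}

/-- `(G, o)` is a regular `K`-ary rooted tree: `G` is a tree, `o` is its root, and every vertex `x`
has exactly `K` children, i.e. neighbours that are one edge further away from the root. -/
def IsKaryTree (G : SimpleGraph V) (o : V) (K : ℕ) : Prop :=
  G.IsTree ∧ ∀ x : V, {y | G.Adj x y ∧ G.dist o y = G.dist o x + 1}.encard = K

/-! ### The metric tree `X` -/

/-- The points of the metric tree `X`, every edge of which is a copy of the unit interval.
A point different from the root lies on exactly one half-open edge, from the parent of a
vertex `vert` (excluded) to `vert` (included); it is recorded by `vert` and by its distance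
`height` from the root (written `|x|`), so that `|vert| - 1 < height ≤ |vert|`.
The root is `(o, 0)`. Both cases are covered by `⌈height⌉₊ = |vert|`. -/
@[ext]
structure Point (G : SimpleGraph V) (o : V) where
  vert : V
  height : ℝ
  height_nonneg : 0 ≤ height
  ceil_height : ⌈height⌉₊ = G.dist o vert

/-- The root, as a point of `X`. -/
def Point.root (G : SimpleGraph V) (o : V) : Point G o := ⟨o, 0, le_rfl, by simp⟩

/-- The Borel σ-algebra of `X`: since `X` has countably many edges, a set is Borel exactly when its
trace on each edge is a Borel set of heights. -/
instance (G : SimpleGraph V) (o : V) : MeasurableSpace (Point G o) :=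
  MeasurableSpace.comap (fun x : Point G o => (x.vert, x.height))
    (@Prod.instMeasurableSpace V ℝ ⊤ inferInstance)

variable {G : SimpleGraph V} {o : V}

/-- `x ≤ y`: the point `x` lies on the geodesic from the root to `y`. -/
def Point.Anc (x y : Point G o) : Prop :=
  x.height ≤ y.height ∧ G.dist o x.vert + G.dist x.vert y.vert = G.dist o y.vert

/-- The geodesic `[x, y]` in `X`: the points `z` on the geodesic from the root to `x` or to `y`
that are not strictly closer to the root than the last common ancestor of `x` and `y`. -/
def geodesic (x y : Point G o) : Set (Point G o) :=
  {z | (z.Anc x ∨ z.Anc y) ∧ ∀ w : Point G o, w.Anc x → w.Anc y → w.Anc z}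

/-- The point at height `t` on the edge that ends in `v` (the root if there is no such point). -/
def edgePoint (G : SimpleGraph V) (o v : V) (t : ℝ) : Point G o :=
  haveI := Classical.propDecidable (0 ≤ t ∧ ⌈t⌉₊ = G.dist o v)
  if h : 0 ≤ t ∧ ⌈t⌉₊ = G.dist o v then ⟨v, t, h.1, h.2⟩ else Point.root G o

/-- The length measure `d|x|`, which is Lebesgue measure (of total mass one) on each edge. -/
def lengthMeasure (G : SimpleGraph V) (o : V) : Measure (Point G o) :=
  Measure.sum fun v : {v : V // v ≠ o} =>
    (volume.restrict (Ioc ((G.dist o v : ℝ) - 1) (G.dist o v))).map (edgePoint G o v)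

/-- The measure `dμ(x) = e^{-β|x|} d|x|` on `X`. -/
def treeMeasure (G : SimpleGraph V) (o : V) (β : ℝ) : Measure (Point G o) :=
  (lengthMeasure G o).withDensity fun x => ENNReal.ofReal (Real.exp (-β * x.height))

/-- `∫_[x,y] g d_X s`, where `d_X s = e^{-ε|z|} d|z|` is the arc length of the uniformizing metric
`d_X(x, y) = ∫_[x,y] e^{-ε|z|} d|z|`. -/
def lineIntegral (ε : ℝ) (g : Point G o → ℝ≥0∞) (x y : Point G o) : ℝ≥0∞ :=
  ∫⁻ z in geodesic x y, g z * ENNReal.ofReal (Real.exp (-ε * z.height)) ∂lengthMeasure G o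

/-- The Borel function `g : X → [0, ∞]` is an upper gradient of `f`, with respect to `d_X`. -/
def IsUpperGradient (ε : ℝ) (f : Point G o → ℝ) (g : Point G o → ℝ≥0∞) : Prop :=
  Measurable g ∧ ∀ x y, ENNReal.ofReal |f x - f y| ≤ lineIntegral ε g x y

/-- The norm `(∫ |f|^p dμ + inf_g ∫ g^p dμ)^{1/p}` of the Newtonian space `N^{1,p}(X)`, where `g`
runs over the upper gradients of `f`. -/
def newtonNorm (ε β p : ℝ) (f : Point G o → ℝ) : ℝ≥0∞ :=
  ((∫⁻ x, ENNReal.ofReal |f x| ^ p ∂treeMeasure G o β) +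
    ⨅ (g : Point G o → ℝ≥0∞) (_ : IsUpperGradient ε f g), ∫⁻ x, g x ^ p ∂treeMeasure G o β)
      ^ (1 / p)

/-- The Newtonian space `N^{1,p}(X)`. -/
def newtonSpace (G : SimpleGraph V) (o : V) (ε β p : ℝ) : Set (Point G o → ℝ) :=
  {f | AEMeasurable f (treeMeasure G o β) ∧ newtonNorm ε β p f < ∞}

/-! ### The boundary `∂X` -/

/-- The boundary `∂X`: the infinite geodesics `ζ = ζ₀ ζ₁ ζ₂ …` in the tree that start at the root.
(It carries a metric that depends on `ε`.) -/
@[ext]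
structure Boundary (G : SimpleGraph V) (o : V) (ε : ℝ) where
  vertex : ℕ → V
  adj : ∀ i, G.Adj (vertex i) (vertex (i + 1))
  dist_vertex : ∀ i, G.dist o (vertex i) = i
  vertex_zero : vertex 0 = o

variable {ε : ℝ}

/-- The number of edges from the root to the geodesic `[ζ, ξ]` (for `ζ ≠ ξ`), i.e. the level of the
last common vertex of `ζ` and `ξ`. -/
def Boundary.level (ζ ξ : Boundary G o ε) : ℕ := PiNat.firstDiff ζ.vertex ξ.vertex - 1

/-- The visual metric on `∂X`: the distance between `ζ ≠ ξ` is
`2 ∫_k^∞ e^{-εt} dt = (2/ε) e^{-εk}`, where `k` is the number of edges from the root to `[ζ, ξ]`. -/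
instance : Dist (Boundary G o ε) where
  dist ζ ξ :=
    haveI := Classical.propDecidable (ζ = ξ)
    if ζ = ξ then 0 else 2 / ε * Real.exp (-ε * ζ.level ξ)

theorem Boundary.dist_self' (ζ : Boundary G o ε) : dist ζ ζ = 0 := by simp [dist]

theorem Boundary.dist_of_ne {ζ ξ : Boundary G o ε} (h : ζ ≠ ξ) :
    dist ζ ξ = 2 / ε * Real.exp (-ε * ζ.level ξ) := by simp [dist, h]

theorem Boundary.dist_comm' (ζ ξ : Boundary G o ε) : dist ζ ξ = dist ξ ζ := by
  by_cases h : ζ = ξ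
  · rw [h]
  · rw [dist_of_ne h, dist_of_ne (Ne.symm h), level, level, PiNat.firstDiff_comm]

theorem Boundary.dist_pos_of_ne [hε : Fact (0 < ε)] {ζ ξ : Boundary G o ε} (h : ζ ≠ ξ) :
    0 < dist ζ ξ := by
  rw [dist_of_ne h]
  have := hε.out
  positivity

theorem Boundary.dist_nonneg' [Fact (0 < ε)] (ζ ξ : Boundary G o ε) : 0 ≤ dist ζ ξ := by
  by_cases h : ζ = ξ
  · rw [h, dist_self']
  · exact (dist_pos_of_ne h).le

theorem Boundary.dist_le_max [hε : Fact (0 < ε)] (ζ ξ η : Boundary G o ε) :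
    dist ζ η ≤ max (dist ζ ξ) (dist ξ η) := by
  by_cases h1 : ζ = ξ
  · subst h1; exact le_max_right _ _
  by_cases h2 : ξ = η
  · subst h2; exact le_max_left _ _
  by_cases h3 : ζ = η
  · subst h3; rw [dist_self']; exact le_max_of_le_left (dist_nonneg' _ _)
  have hne : ζ.vertex ≠ η.vertex := fun h => h3 (Boundary.ext h)
  have hmin := PiNat.min_firstDiff_le ζ.vertex ξ.vertex η.vertex hne
  have hε0 := hε.out
  have key : ∀ {a b : ℕ}, a ≤ b →
      2 / ε * Real.exp (-ε * (b : ℝ)) ≤ 2 / ε * Real.exp (-ε * (a : ℝ)) := by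
    intro a b hab
    have : (a : ℝ) ≤ b := by exact_mod_cast hab
    gcongr 2 / ε * Real.exp ?_
    nlinarith
  rw [dist_of_ne h1, dist_of_ne h2, dist_of_ne h3]
  rcases min_le_iff.mp hmin with h | h
  · exact le_max_of_le_left (key (Nat.sub_le_sub_right h 1))
  · exact le_max_of_le_right (key (Nat.sub_le_sub_right h 1))

instance [Fact (0 < ε)] : MetricSpace (Boundary G o ε) where
  dist_self := Boundary.dist_self'
  dist_comm := Boundary.dist_comm'
  dist_triangle ζ ξ η := by
    have h := Boundary.dist_le_max ζ ξ η
    have h1 := Boundary.dist_nonneg' ζ ξ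
    have h2 := Boundary.dist_nonneg' ξ η
    exact h.trans (max_le (by linarith) (by linarith))
  eq_of_dist_eq_zero := by
    intro ζ ξ h
    by_contra hne
    exact (Boundary.dist_pos_of_ne hne).ne' h

instance [Fact (0 < ε)] : MeasurableSpace (Boundary G o ε) := borel _

instance [Fact (0 < ε)] : BorelSpace (Boundary G o ε) := ⟨rfl⟩

/-- The normalized Hausdorff measure `ν` on the boundary of a `K`-ary tree, of dimension
`Q = log K / ε`. -/
def boundaryMeasure (G : SimpleGraph V) (o : V) (K : ℕ) (ε : ℝ) [Fact (0 < ε)] :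
    Measure (Boundary G o ε) :=
  (Measure.hausdorffMeasure (Real.log K / ε) (univ : Set (Boundary G o ε)))⁻¹ •
    Measure.hausdorffMeasure (Real.log K / ε)

/-! ### Besov spaces on `∂X` -/

/-- `E_p(u, t)`, the `p`-th root of
`∫ (average over ξ in the open ball B(ζ, t) of |u(ζ) - u(ξ)|^p) dν(ζ)`. -/
def besovE [Fact (0 < ε)] (K : ℕ) (p : ℝ) (u : Boundary G o ε → ℝ) (t : ℝ) : ℝ≥0∞ :=
  (∫⁻ ζ, (⨍⁻ ξ in Metric.ball ζ t, ENNReal.ofReal |u ζ - u ξ| ^ p ∂boundaryMeasure G o K ε)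
    ∂boundaryMeasure G o K ε) ^ (1 / p)

/-- The Besov seminorm `(∫_0^∞ (E_p(u, t) / t^θ)^q dt/t)^{1/q}`. -/
def besovSeminorm [Fact (0 < ε)] (K : ℕ) (θ p q : ℝ) (u : Boundary G o ε → ℝ) : ℝ≥0∞ :=
  (∫⁻ t in Ioi (0 : ℝ), (besovE K p u t / ENNReal.ofReal (t ^ θ)) ^ q / ENNReal.ofReal t)
    ^ (1 / q)

/-- The Besov norm `‖u‖_{L^p(∂X)} + ‖u‖_{B^θ_{p,q}(∂X)}`. -/
def besovNorm [Fact (0 < ε)] (K : ℕ) (θ p q : ℝ) (u : Boundary G o ε → ℝ) : ℝ≥0∞ :=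
  eLpNorm u (ENNReal.ofReal p) (boundaryMeasure G o K ε) + besovSeminorm K θ p q u

/-- The Besov space `B^θ_{p,q}(∂X)`. -/
def besovSpace (G : SimpleGraph V) (o : V) (K : ℕ) (ε : ℝ) [Fact (0 < ε)] (θ p q : ℝ) :
    Set (Boundary G o ε → ℝ) :=
  {u | MemLp u (ENNReal.ofReal p) (boundaryMeasure G o K ε) ∧ besovSeminorm K θ p q u < ∞}

/-! ### Traces -/

/-- The point at height `t` on the geodesic ray `[0, ζ)`. -/
def Boundary.ray (ζ : Boundary G o ε) (t : ℝ≥0) : Point G o :=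
  ⟨ζ.vertex ⌈(t : ℝ)⌉₊, t, t.2, (ζ.dist_vertex _).symm⟩

/-- `Tr f = u`: for `ν`-almost every `ζ`, the limit of `f(x)` as `x → ζ` along the geodesic ray
`[0, ζ)` exists and equals `u(ζ)`. -/
def IsTrace [Fact (0 < ε)] (K : ℕ) (f : Point G o → ℝ) (u : Boundary G o ε → ℝ) : Prop :=
  ∀ᵐ ζ ∂boundaryMeasure G o K ε, Tendsto (fun t : ℝ≥0 => f (ζ.ray t)) atTop (𝓝 (u ζ))

/-- The trace space of `N^{1,p}(X)` on `∂X`. -/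
def traceSpace (G : SimpleGraph V) (o : V) (K : ℕ) (ε : ℝ) [Fact (0 < ε)] (β p : ℝ) :
    Set (Boundary G o ε → ℝ) :=
  {u | ∃ f ∈ newtonSpace G o ε β p, IsTrace K f u}

/-- The norm of the trace space: the infimum of `‖f‖_{N^{1,p}(X)}` over all `f` in `N^{1,p}(X)`
with trace `u`. -/
def traceNorm [Fact (0 < ε)] (K : ℕ) (β p : ℝ) (u : Boundary G o ε → ℝ) : ℝ≥0∞ :=
  ⨅ (f : Point G o → ℝ) (_ : f ∈ newtonSpace G o ε β p ∧ IsTrace K f u), newtonNorm ε β p f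

end KTree

end

/-!
On `∂X` every ball is a cylinder, the set of rays through a fixed vertex, and a cylinder of level
`n` has `ν`-mass `K⁻ⁿ`: this is the mass distribution principle, where a cover of too small mass
would leave at each under-covered vertex an under-covered child, and so a ray that is not covered.
Hence the `p`-th power of the Besov seminorm is comparable to `∑ₙ e^{θpεn} oscₙ(u)`, where `oscₙ(u)`
is the mean oscillation of `u` over the cylinders of level `n`, and `∫ h dμ` over the edges of level
`n` is an integral of edge averages over `∂X` with the weight `(K e^{-β})ⁿ`, up to constants.

If `g` is an upper gradient of `f`, then along a ray `ζ` the value of `f` at the level `n` differs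
from its limit by at most the tail of the edge integrals of `g`. The weighted Hardy inequality for
these tails bounds `∑ₙ e^{θpεn} oscₙ(Tr f)` by `∫ g^p dμ`. Conversely, the averages of `u` over
cylinders, interpolated linearly along the edges, have an upper gradient whose energy is controlled
by the differences of consecutive averages and hence by the oscillations `oscₙ(u)`.
-/

noncomputable section

namespace KTree

/-! ### Parents and descendants of vertices -/

section Vertices

variable {V : Type*} {G : SimpleGraph V} {o v w x y : V} {m n : ℕ}

open Classical in
/-- The neighbour of `v` that is closer to the root (`v` itself if `v` is the root). -/
def parent (G : SimpleGraph V) (o v : V) : V :=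
  if h : ∃ w, G.Adj v w ∧ G.dist o v = G.dist o w + 1 then h.choose else v

/-- The vertex of level `n` on the geodesic from the root to `v` (`v` itself if its level is less
than `n`). -/
def above (G : SimpleGraph V) (o : V) (n : ℕ) (v : V) : V :=
  (parent G o)^[G.dist o v - n] v

/-- The children of the vertex `v`. -/
def children (G : SimpleGraph V) (o v : V) : Set V := {w | w ≠ o ∧ parent G o w = v}

/-- The vertices `w` such that `v` lies on the geodesic from the root to `w`. -/
def subtree (G : SimpleGraph V) (o v : V) : Set V := {w | above G o (G.dist o v) w = v}

/-- The vertices of the subtree of `v` that are `m` levels below `v`. -/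
def descendants (G : SimpleGraph V) (o : V) (m : ℕ) (v : V) : Set V :=
  {w | w ∈ subtree G o v ∧ G.dist o w = G.dist o v + m}

theorem exists_adj_dist_eq_add_one (hG : G.Connected) (h : v ≠ x) :
    ∃ w, G.Adj v w ∧ G.dist x v = G.dist x w + 1 := by
  obtain ⟨p, hp⟩ := hG.exists_walk_length_eq_dist v x
  cases p with
  | nil => exact absurd rfl h
  | @cons _ w _ hadj q =>
    refine ⟨w, hadj, ?_⟩
    have hle := SimpleGraph.dist_le q
    have hdiff := hadj.diff_dist_adj (u := x)
    rw [SimpleGraph.Walk.length_cons, G.dist_comm] at hp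
    rw [G.dist_comm] at hle
    omega

theorem eq_of_adj_of_dist_eq_add_one (hT : G.IsTree) {w₁ w₂ : V} (h₁ : G.Adj v w₁)
    (h₂ : G.Adj v w₂) (d₁ : G.dist v o = G.dist w₁ o + 1) (d₂ : G.dist v o = G.dist w₂ o + 1) :
    w₁ = w₂ := by
  obtain ⟨p₁, hp₁⟩ := hT.connected.exists_walk_length_eq_dist w₁ o
  obtain ⟨p₂, hp₂⟩ := hT.connected.exists_walk_length_eq_dist w₂ o
  have q₁ := (SimpleGraph.Walk.cons h₁ p₁).isPath_of_length_eq_dist (by simp [hp₁, d₁])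
  have q₂ := (SimpleGraph.Walk.cons h₂ p₂).isPath_of_length_eq_dist (by simp [hp₂, d₂])
  have hunique := hT.isAcyclic.subsingleton_path v o
  simpa using congrArg (fun p : G.Path v o => p.1.snd) (hunique.elim ⟨_, q₁⟩ ⟨_, q₂⟩)

theorem parent_spec (hG : G.Connected) (hv : v ≠ o) :
    G.Adj v (parent G o v) ∧ G.dist o v = G.dist o (parent G o v) + 1 := by
  have h := exists_adj_dist_eq_add_one hG hv
  rw [parent, dif_pos h]
  exact h.choose_spec

theorem parent_root : parent G o o = o := by
  rw [parent, dif_neg]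
  rintro ⟨w, -, h⟩
  simp at h

theorem dist_parent (hG : G.Connected) (v : V) : G.dist o (parent G o v) = G.dist o v - 1 := by
  rcases eq_or_ne v o with rfl | hv
  · simp [parent_root]
  · have := (parent_spec hG hv).2
    omega

theorem ne_root_of_dist (h : G.dist o v = n + 1) : v ≠ o := by
  rintro rfl
  simp at h

theorem parent_eq (hT : G.IsTree) (h : G.Adj v w) (d : G.dist o v = G.dist o w + 1) :
    parent G o v = w := by
  obtain ⟨hadj, hdist⟩ := parent_spec hT.connected (ne_root_of_dist d)
  refine eq_of_adj_of_dist_eq_add_one (o := o) hT hadj h ?_ ?_ <;>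
    rwa [G.dist_comm, G.dist_comm (v := o)]

theorem mem_children_iff (hT : G.IsTree) :
    w ∈ children G o v ↔ G.Adj v w ∧ G.dist o w = G.dist o v + 1 := by
  constructor
  · rintro ⟨hw, rfl⟩
    exact (parent_spec hT.connected hw).imp_left fun h => h.symm
  · rintro ⟨h, d⟩
    exact ⟨ne_root_of_dist d, parent_eq hT h.symm d⟩

theorem dist_iterate_parent (hG : G.Connected) (v : V) (k : ℕ) :
    G.dist o ((parent G o)^[k] v) = G.dist o v - k := by
  induction k with
  | zero => simp
  | succ k ih => rw [Function.iterate_succ_apply', dist_parent hG, ih, Nat.sub_sub]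

theorem dist_above (hG : G.Connected) (n : ℕ) (v : V) :
    G.dist o (above G o n v) = min n (G.dist o v) := by
  rw [above, dist_iterate_parent hG]
  omega

@[simp] theorem above_dist_self (v : V) : above G o (G.dist o v) v = v := by
  simp [above]

theorem above_above (hG : G.Connected) (hmn : m ≤ n) (v : V) :
    above G o m (above G o n v) = above G o m v := by
  rw [above, dist_above hG, above, above, ← Function.iterate_add_apply]
  congr 2
  omega

theorem above_pred (hG : G.Connected) (v : V) :
    above G o (G.dist o v - 1) v = parent G o v := by
  rcases eq_or_ne v o with rfl | hv
  · simp [above, parent_root]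
  · have := hG.pos_dist_of_ne hv.symm
    rw [above, show G.dist o v - (G.dist o v - 1) = 1 by omega, Function.iterate_one]

theorem above_parent (hG : G.Connected) (h : n < G.dist o v) :
    above G o n (parent G o v) = above G o n v := by
  rw [← above_pred hG, above_above hG (by omega)]

theorem dist_iterate_parent_self_le (hG : G.Connected) (v : V) (k : ℕ) :
    G.dist ((parent G o)^[k] v) v ≤ k := by
  induction k with
  | zero => simp
  | succ k ih =>
    rw [Function.iterate_succ_apply']
    generalize (parent G o)^[k] v = w at ih ⊢
    have hstep : G.dist (parent G o w) w ≤ 1 := by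
      rcases eq_or_ne w o with rfl | hw
      · simp [parent_root]
      · exact (SimpleGraph.dist_eq_one_iff_adj.2 (parent_spec hG hw).1.symm).le
    have := hG.dist_triangle (u := parent G o w) (v := w) (w := v)
    omega

theorem self_mem_subtree (v : V) : v ∈ subtree G o v := above_dist_self v

theorem above_mem_subtree (hG : G.Connected) (n : ℕ) (v : V) :
    v ∈ subtree G o (above G o n v) := by
  rw [subtree, mem_ofPred_eq, dist_above hG]
  rcases le_total n (G.dist o v) with h | h
  · rw [min_eq_left h]
  · rw [min_eq_right h, above_dist_self, above, Nat.sub_eq_zero_of_le h,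
      Function.iterate_zero_apply]

theorem dist_le_of_mem_subtree (hG : G.Connected) (h : w ∈ subtree G o v) :
    G.dist o v ≤ G.dist o w := by
  have := dist_above (o := o) hG (G.dist o v) w
  rw [show above G o (G.dist o v) w = v from h] at this
  omega

theorem above_eq_of_mem_subtree (hG : G.Connected) (h : w ∈ subtree G o v)
    (hn : n ≤ G.dist o v) : above G o n w = above G o n v := by
  rw [← above_above hG hn w, show above G o (G.dist o v) w = v from h]

theorem subtree_subset_subtree (hG : G.Connected) (h : w ∈ subtree G o v) :
    subtree G o w ⊆ subtree G o v := fun _ hx =>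
  (above_eq_of_mem_subtree hG hx (dist_le_of_mem_subtree hG h)).trans h

theorem mem_subtree_of_mem_subtree (hG : G.Connected) (hv : x ∈ subtree G o v)
    (hw : x ∈ subtree G o w) (h : G.dist o v ≤ G.dist o w) : w ∈ subtree G o v :=
  (above_eq_of_mem_subtree hG hw h).symm.trans hv

theorem mem_subtree_parent (hG : G.Connected) (v : V) : v ∈ subtree G o (parent G o v) := by
  rw [← above_pred hG]
  exact above_mem_subtree hG _ v

theorem mem_subtree_iff (hT : G.IsTree) :
    w ∈ subtree G o v ↔ G.dist o v + G.dist v w = G.dist o w := by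
  constructor
  · intro h
    have hle : G.dist v w ≤ G.dist o w - G.dist o v := by
      conv_lhs => rw [← show above G o (G.dist o v) w = v from h]
      exact dist_iterate_parent_self_le hT.connected w _
    have := hT.connected.dist_triangle (u := o) (v := v) (w := w)
    have := dist_le_of_mem_subtree hT.connected h
    omega
  · intro h
    induction hk : G.dist v w generalizing w with
    | zero => exact hT.connected.dist_eq_zero_iff.1 hk ▸ self_mem_subtree v
    | succ k ih =>
      obtain ⟨x, hadj, hx⟩ := exists_adj_dist_eq_add_one (x := v) hT.connected
        (v := w) fun e => by simp [e] at hk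
      have htriangle := hT.connected.dist_triangle (u := o) (v := v) (w := x)
      have hdiff := hadj.diff_dist_adj (u := o)
      have hpar : parent G o w = x := parent_eq hT hadj (by omega)
      have hx_mem : x ∈ subtree G o v := ih (by omega) (by omega)
      exact subtree_subset_subtree hT.connected hx_mem (hpar ▸ mem_subtree_parent hT.connected w)

theorem eq_of_mem_subtree (hv : x ∈ subtree G o v) (hw : x ∈ subtree G o w)
    (h : G.dist o v = G.dist o w) : v = w := by
  have hv' : above G o (G.dist o v) x = v := hv
  rw [← hv', h, hw]

theorem mem_subtree_root (hG : G.Connected) (v : V) : v ∈ subtree G o o := by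
  have := dist_above (o := o) hG 0 v
  rw [subtree, mem_ofPred_eq, SimpleGraph.dist_self]
  exact (hG.dist_eq_zero_iff.1 (this.trans (by simp))).symm

theorem descendants_zero (v : V) : descendants G o 0 v = {v} := by
  ext w
  constructor
  · rintro ⟨h, d⟩
    exact eq_of_mem_subtree (self_mem_subtree w) h d
  · rintro rfl
    exact ⟨self_mem_subtree w, rfl⟩

theorem mem_descendants_root (hG : G.Connected) : v ∈ descendants G o n o ↔ G.dist o v = n := by
  simp [descendants, mem_subtree_root hG]

theorem descendants_succ (hG : G.Connected) (m : ℕ) (v : V) :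
    descendants G o (m + 1) v = ⋃ x ∈ descendants G o m v, children G o x := by
  ext w
  simp only [mem_iUnion, exists_prop]
  constructor
  · rintro ⟨h, d⟩
    have hw : w ≠ o := ne_root_of_dist (n := G.dist o v + m) d
    have hd := dist_parent (o := o) hG w
    exact ⟨parent G o w, ⟨mem_subtree_of_mem_subtree hG h (mem_subtree_parent hG w) (by omega),
      by omega⟩, hw, rfl⟩
  · rintro ⟨_, ⟨h, d⟩, hw, rfl⟩
    exact ⟨subtree_subset_subtree hG h (mem_subtree_parent hG w),
      by rw [(parent_spec hG hw).2, d, add_assoc]⟩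

theorem pairwiseDisjoint_children (s : Set V) : s.PairwiseDisjoint (children G o) :=
  fun _ _ _ _ hne => disjoint_left.2 fun _ h h' => hne (h.2.symm.trans h'.2)

theorem tsum_descendants_succ (hG : G.Connected) (m : ℕ) (v : V) (f : V → ℝ≥0∞) :
    ∑' w : descendants G o (m + 1) v, f w =
      ∑' x : descendants G o m v, ∑' w : children G o (x : V), f w := by
  rw [descendants_succ hG, ENNReal.tsum_biUnion' (pairwiseDisjoint_children _)]

end Vertices

section IsKaryTree

variable {V : Type*} {G : SimpleGraph V} {o : V} {K : ℕ}

theorem IsKaryTree.isTree (hG : IsKaryTree G o K) : G.IsTree := hG.1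

theorem IsKaryTree.connected (hG : IsKaryTree G o K) : G.Connected := hG.isTree.connected

theorem IsKaryTree.encard_children (hG : IsKaryTree G o K) (v : V) :
    (children G o v).encard = K := by
  rw [← hG.2 v]
  congr 1
  ext w
  exact mem_children_iff hG.isTree

theorem IsKaryTree.tsum_children (hG : IsKaryTree G o K) (v : V) (c : ℝ≥0∞) :
    ∑' _ : children G o v, c = K * c := by
  rw [ENNReal.tsum_const, ← Set.encard, hG.encard_children v, ENat.toENNReal_coe]

theorem IsKaryTree.children_nonempty (hK : K ≠ 0) (hG : IsKaryTree G o K) (v : V) :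
    (children G o v).Nonempty := by
  rw [← Set.encard_ne_zero, hG.encard_children v]
  exact_mod_cast hK

theorem IsKaryTree.tsum_descendants (hG : IsKaryTree G o K) (m : ℕ) (v : V) (c : ℝ≥0∞) :
    ∑' _ : descendants G o m v, c = K ^ m * c := by
  induction m with
  | zero => simp [descendants_zero]
  | succ m ih =>
    rw [tsum_descendants_succ hG.connected m v fun _ => c]
    simp only [hG.tsum_children, ENNReal.tsum_mul_left, ih]
    ring

theorem IsKaryTree.countable (hG : IsKaryTree G o K) : Countable V := by
  have hlevel (n : ℕ) : (descendants G o n o).Countable := by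
    induction n with
    | zero => simp [descendants_zero]
    | succ n ih =>
      rw [descendants_succ hG.connected]
      exact ih.biUnion fun v _ => (Set.finite_of_encard_eq_coe (hG.encard_children v)).countable
  refine Set.countable_univ_iff.1 ((Set.countable_iUnion hlevel).mono fun v _ => ?_)
  exact mem_iUnion.2 ⟨G.dist o v, (mem_descendants_root hG.connected).2 rfl⟩

end IsKaryTree

/-! ### Cylinders in the boundary -/

section Cylinders

variable {V : Type*} {G : SimpleGraph V} {o : V} {ε : ℝ} {m n : ℕ}

/-- The geodesic rays that pass through the vertex `v`. -/
def cylinder (ε : ℝ) (v : V) : Set (Boundary G o ε) := {ζ | ζ.vertex (G.dist o v) = v}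

theorem Boundary.parent_vertex (hT : G.IsTree) (ζ : Boundary G o ε) (n : ℕ) :
    parent G o (ζ.vertex (n + 1)) = ζ.vertex n :=
  parent_eq hT (ζ.adj n).symm (by simp [ζ.dist_vertex])

theorem Boundary.vertex_succ_ne_root (ζ : Boundary G o ε) (n : ℕ) : ζ.vertex (n + 1) ≠ o :=
  ne_root_of_dist (ζ.dist_vertex (n + 1))

theorem Boundary.above_vertex (hT : G.IsTree) (ζ : Boundary G o ε) (hmn : m ≤ n) :
    above G o m (ζ.vertex n) = ζ.vertex m := by
  induction n, hmn using Nat.le_induction with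
  | base => simp [above, ζ.dist_vertex m]
  | succ n hn ih =>
    rw [← above_parent hT.connected (by rw [ζ.dist_vertex]; omega), ζ.parent_vertex hT, ih]

theorem Boundary.vertex_mem_subtree (hT : G.IsTree) (ζ : Boundary G o ε) (hmn : m ≤ n) :
    ζ.vertex n ∈ subtree G o (ζ.vertex m) := by
  rw [subtree, mem_ofPred_eq, ζ.dist_vertex, ζ.above_vertex hT hmn]

theorem Boundary.vertex_eq_of_le (hT : G.IsTree) {ζ ξ : Boundary G o ε} (hmn : m ≤ n)
    (h : ζ.vertex n = ξ.vertex n) : ζ.vertex m = ξ.vertex m := by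
  rw [← ζ.above_vertex hT hmn, h, ξ.above_vertex hT hmn]

theorem mem_cylinder_vertex_iff {ζ ξ : Boundary G o ε} :
    ξ ∈ cylinder ε (ζ.vertex n) ↔ ξ.vertex n = ζ.vertex n := by
  simp [cylinder, ζ.dist_vertex]

theorem Boundary.mem_cylinder_vertex (ζ : Boundary G o ε) (n : ℕ) :
    ζ ∈ cylinder ε (ζ.vertex n) := mem_cylinder_vertex_iff.2 rfl

theorem cylinder_root : cylinder ε o = (univ : Set (Boundary G o ε)) := by
  ext ζ
  simp [cylinder, ζ.vertex_zero]

theorem Boundary.le_level_iff (hT : G.IsTree) {ζ ξ : Boundary G o ε} (h : ζ ≠ ξ) :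
    n ≤ ζ.level ξ ↔ ζ.vertex n = ξ.vertex n := by
  have hne : ζ.vertex ≠ ξ.vertex := fun h' => h (Boundary.ext h')
  have hdiff := PiNat.apply_firstDiff_ne hne
  have hpos : PiNat.firstDiff ζ.vertex ξ.vertex ≠ 0 := fun h0 =>
    hdiff (by rw [h0, ζ.vertex_zero, ξ.vertex_zero])
  rw [level]
  refine ⟨fun hn => PiNat.apply_eq_of_lt_firstDiff (by omega), fun hn => ?_⟩
  by_contra hlt
  exact hdiff (Boundary.vertex_eq_of_le hT (by omega) hn)

theorem exists_forall_vertex (hT : G.IsTree) (P : V → Prop) (h0 : P o)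
    (h : ∀ v, P v → ∃ w ∈ children G o v, P w) : ∃ ζ : Boundary G o ε, ∀ n, P (ζ.vertex n) := by
  choose! c hc hPc using h
  have hP (n : ℕ) : P (c^[n] o) := by
    induction n with
    | zero => exact h0
    | succ n ih => rw [Function.iterate_succ_apply']; exact hPc _ ih
  have hadj (n : ℕ) : G.Adj (c^[n] o) (c^[n + 1] o) ∧
      G.dist o (c^[n + 1] o) = G.dist o (c^[n] o) + 1 := by
    rw [Function.iterate_succ_apply']
    exact (mem_children_iff hT).1 (hc _ (hP n))
  refine ⟨⟨fun n => c^[n] o, fun n => (hadj n).1, fun n => ?_, rfl⟩, hP⟩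
  induction n with
  | zero => simp
  | succ n ih => rw [(hadj n).2, ih]

theorem exists_mem_cylinder_forall_vertex (hT : G.IsTree) (P : V → Prop) {v : V} (hv : P v)
    (h : ∀ x, P x → ∃ w ∈ children G o x, P w) :
    ∃ ζ : Boundary G o ε, ζ ∈ cylinder ε v ∧ ∀ n, G.dist o v ≤ n → P (ζ.vertex n) := by
  have hG := hT.connected
  let Q (x : V) : Prop := v ∈ subtree G o x ∨ x ∈ subtree G o v ∧ P x
  have hQ (x : V) (hx : P x) (hxv : x ∈ subtree G o v) : ∃ w ∈ children G o x, Q w := by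
    obtain ⟨w, hw, hPw⟩ := h x hx
    exact ⟨w, hw, .inr ⟨subtree_subset_subtree hG hxv (hw.2 ▸ mem_subtree_parent hG w), hPw⟩⟩
  obtain ⟨ζ, hζ⟩ := exists_forall_vertex (ε := ε) hT Q (.inl (mem_subtree_root hG v)) <| by
    rintro x (hx | ⟨hxv, hx⟩)
    · rcases eq_or_ne x v with rfl | hne
      · exact hQ x hv (self_mem_subtree x)
      have hlt : G.dist o x < G.dist o v := (dist_le_of_mem_subtree hG hx).lt_of_ne fun he =>
        hne (eq_of_mem_subtree hx (self_mem_subtree v) he)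
      have hdist : G.dist o (above G o (G.dist o x + 1) v) = G.dist o x + 1 := by
        rw [dist_above hG, min_eq_left hlt]
      refine ⟨above G o (G.dist o x + 1) v, ⟨ne_root_of_dist hdist, ?_⟩,
        .inl (above_mem_subtree hG _ v)⟩
      rw [← above_pred hG, hdist, above_above hG (by omega)]
      exact hx
    · exact hQ x hx hxv
  have hv_mem : ζ.vertex (G.dist o v) = v := by
    rcases hζ (G.dist o v) with h | ⟨h, -⟩
    · exact eq_of_mem_subtree h (self_mem_subtree v) (ζ.dist_vertex _)
    · exact eq_of_mem_subtree (self_mem_subtree _) h (ζ.dist_vertex _)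
  refine ⟨ζ, hv_mem, fun n hn => ?_⟩
  rcases hζ n with h | ⟨-, h⟩
  · have := dist_le_of_mem_subtree hG h
    rw [ζ.dist_vertex] at this
    rwa [this.antisymm hn, hv_mem]
  · exact h

/-- The distance between two rays whose last common vertex has level `n`. -/
def visualRadius (ε : ℝ) (n : ℕ) : ℝ := 2 / ε * Real.exp (-ε * n)

theorem visualRadius_pos (hε : 0 < ε) (n : ℕ) : 0 < visualRadius ε n := by
  unfold visualRadius
  positivity

theorem visualRadius_strictAnti (hε : 0 < ε) : StrictAnti (visualRadius ε) := by
  intro m n hmn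
  have hcast : (m : ℝ) < n := by exact_mod_cast hmn
  unfold visualRadius
  gcongr 2 / ε * Real.exp ?_
  nlinarith

theorem tendsto_visualRadius (hε : 0 < ε) : Tendsto (visualRadius ε) atTop (𝓝 0) := by
  rw [show (0 : ℝ) = 2 / ε * 0 by simp]
  refine Tendsto.const_mul _ (Real.tendsto_exp_atBot.comp ?_)
  exact tendsto_natCast_atTop_atTop.const_mul_atTop_of_neg (by linarith)

theorem Boundary.dist_of_ne_eq_visualRadius {ζ ξ : Boundary G o ε} (h : ζ ≠ ξ) :
    dist ζ ξ = visualRadius ε (ζ.level ξ) := dist_of_ne h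

variable [hε : Fact (0 < ε)]

theorem Boundary.dist_le_visualRadius_iff (hT : G.IsTree) {ζ ξ : Boundary G o ε} :
    dist ζ ξ ≤ visualRadius ε n ↔ ζ.vertex n = ξ.vertex n := by
  rcases eq_or_ne ζ ξ with rfl | hne
  · simp [(visualRadius_pos hε.out n).le]
  · rw [dist_of_ne_eq_visualRadius hne, (visualRadius_strictAnti hε.out).le_iff_ge,
      le_level_iff hT hne]

theorem Boundary.dist_lt_visualRadius_iff (hT : G.IsTree) {ζ ξ : Boundary G o ε} :
    dist ζ ξ < visualRadius ε n ↔ ζ.vertex (n + 1) = ξ.vertex (n + 1) := by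
  rcases eq_or_ne ζ ξ with rfl | hne
  · simp [visualRadius_pos hε.out n]
  · rw [dist_of_ne_eq_visualRadius hne, (visualRadius_strictAnti hε.out).lt_iff_gt,
      ← le_level_iff hT hne, Nat.succ_le_iff]

theorem ball_eq_cylinder (hT : G.IsTree) (ζ : Boundary G o ε) {t : ℝ}
    (ht : t ∈ Ioc (visualRadius ε (n + 1)) (visualRadius ε n)) :
    Metric.ball ζ t = cylinder ε (ζ.vertex (n + 1)) := by
  ext ξ
  rw [Metric.mem_ball, mem_cylinder_vertex_iff]
  exact ⟨fun h => (Boundary.dist_lt_visualRadius_iff hT).1 (h.trans_le ht.2),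
    fun h => ((Boundary.dist_le_visualRadius_iff hT).2 h).trans_lt ht.1⟩

theorem ball_eq_univ (hT : G.IsTree) (ζ : Boundary G o ε) {t : ℝ} (ht : visualRadius ε 0 < t) :
    Metric.ball ζ t = univ :=
  eq_univ_of_forall fun ξ => Metric.mem_ball.2 <| lt_of_le_of_lt
    ((Boundary.dist_le_visualRadius_iff hT).2 (by rw [ξ.vertex_zero, ζ.vertex_zero])) ht

theorem isOpen_cylinder (hT : G.IsTree) (v : V) : IsOpen (cylinder ε v : Set (Boundary G o ε)) := by
  refine Metric.isOpen_iff.2 fun ζ hζ => ?_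
  refine ⟨visualRadius ε (G.dist o v), visualRadius_pos hε.out _, fun ξ hξ => ?_⟩
  exact ((Boundary.dist_le_visualRadius_iff hT).1 (Metric.mem_ball.1 hξ).le).trans hζ

theorem measurableSet_cylinder (hT : G.IsTree) (v : V) :
    MeasurableSet (cylinder ε v : Set (Boundary G o ε)) := (isOpen_cylinder hT v).measurableSet

theorem measurableSet_vertex_eq (hT : G.IsTree) (n : ℕ) (v : V) :
    MeasurableSet {ζ : Boundary G o ε | ζ.vertex n = v} := by
  by_cases h : G.dist o v = n
  · subst h
    exact measurableSet_cylinder hT v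
  · convert MeasurableSet.empty
    refine eq_empty_of_forall_notMem fun ζ hζ => h ?_
    rw [← show ζ.vertex n = v from hζ, ζ.dist_vertex]

theorem measurable_comp_vertex [Countable V] (hT : G.IsTree) {β : Type*} [MeasurableSpace β]
    (h : V → β) (n : ℕ) : Measurable fun ζ : Boundary G o ε => h (ζ.vertex n) := by
  let _ : MeasurableSpace V := ⊤
  have : Measurable fun ζ : Boundary G o ε => ζ.vertex n :=
    measurable_to_countable' fun v => measurableSet_vertex_eq hT n v
  exact measurable_from_top.comp this

end Cylinders

/-! ### The Hausdorff measure of cylinders -/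

section InvPow

variable {K : ℕ}

theorem natCast_mul_inv_cancel (hK : K ≠ 0) : (K : ℝ≥0∞) * (K : ℝ≥0∞)⁻¹ = 1 :=
  ENNReal.mul_inv_cancel (by exact_mod_cast hK) (ENNReal.natCast_ne_top K)

theorem natCast_pow_mul_inv_pow (hK : K ≠ 0) (n : ℕ) : (K : ℝ≥0∞) ^ n * (K : ℝ≥0∞)⁻¹ ^ n = 1 := by
  rw [← mul_pow, natCast_mul_inv_cancel hK, one_pow]

theorem natCast_mul_inv_pow_succ (hK : K ≠ 0) (n : ℕ) :
    (K : ℝ≥0∞) * (K : ℝ≥0∞)⁻¹ ^ (n + 1) = (K : ℝ≥0∞)⁻¹ ^ n := by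
  rw [pow_succ', ← mul_assoc, natCast_mul_inv_cancel hK, one_mul]

theorem antitone_inv_natCast_pow (hK : K ≠ 0) : Antitone fun n : ℕ => (K : ℝ≥0∞)⁻¹ ^ n :=
  pow_right_anti₀ zero_le <| ENNReal.inv_le_one.2 <| by
    exact_mod_cast Nat.one_le_iff_ne_zero.2 hK

theorem ofReal_exp_natCast_mul_log (hK : K ≠ 0) (n : ℕ) :
    ENNReal.ofReal (Real.exp (n * Real.log K)) = (K : ℝ≥0∞) ^ n := by
  rw [Real.exp_nat_mul, Real.exp_log (by positivity), ENNReal.ofReal_pow (by positivity),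
    ENNReal.ofReal_natCast]

end InvPow

section CoverMass

variable {V : Type*} {G : SimpleGraph V} {o : V} {K : ℕ} {ε : ℝ} {ι : Type*}

/-- The total weight of the vertices `w i` in the subtree of `x`, where a vertex of level `n` has
weight `K⁻ⁿ`. -/
def coverMass (G : SimpleGraph V) (o : V) (K : ℕ) (w : ι → V) (x : V) : ℝ≥0∞ :=
  ∑' i, (subtree G o x).indicator (fun y => (K : ℝ≥0∞)⁻¹ ^ G.dist o y) (w i)

theorem coverMass_le_tsum (w : ι → V) (x : V) :
    coverMass G o K w x ≤ ∑' i, (K : ℝ≥0∞)⁻¹ ^ G.dist o (w i) :=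
  ENNReal.tsum_le_tsum fun _ => indicator_le_self _ _ _

theorem inv_pow_le_coverMass (w : ι → V) (i : ι) :
    (K : ℝ≥0∞)⁻¹ ^ G.dist o (w i) ≤ coverMass G o K w (w i) := by
  refine le_of_eq_of_le ?_ (ENNReal.le_tsum i)
  rw [indicator_of_mem (self_mem_subtree (w i))]

theorem tsum_children_coverMass_le (hG : G.Connected) (w : ι → V) (x : V) :
    ∑' y : children G o x, coverMass G o K w y ≤ coverMass G o K w x := by
  have hdist (y : children G o x) : G.dist o (y : V) = G.dist o x + 1 := by
    rw [(parent_spec hG y.2.1).2, y.2.2]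
  have hdisj : Pairwise (Function.onFun Disjoint fun y : children G o x => subtree G o (y : V)) :=
    fun y z hne => disjoint_left.2 fun _ hy hz =>
      hne (Subtype.ext (eq_of_mem_subtree hy hz (by rw [hdist, hdist])))
  have hsub : ⋃ y : children G o x, subtree G o (y : V) ⊆ subtree G o x :=
    iUnion_subset fun y => subtree_subset_subtree hG <| by
      have hy := mem_subtree_parent (o := o) hG (y : V)
      rwa [y.2.2] at hy
  simp only [coverMass]
  rw [ENNReal.tsum_comm]
  refine ENNReal.tsum_le_tsum fun i => ?_
  rw [← congrFun (indicator_iUnion_of_pairwise_disjoint _ hdisj _) (w i)]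
  exact indicator_le_indicator_of_subset hsub (fun _ => zero_le) (w i)

theorem IsKaryTree.exists_child_coverMass_lt (hK : K ≠ 0) (hG : IsKaryTree G o K) (w : ι → V)
    {x : V} (hx : coverMass G o K w x < (K : ℝ≥0∞)⁻¹ ^ G.dist o x) :
    ∃ y ∈ children G o x, coverMass G o K w y < (K : ℝ≥0∞)⁻¹ ^ G.dist o y := by
  by_contra! hcon
  refine hx.not_ge ?_
  calc (K : ℝ≥0∞)⁻¹ ^ G.dist o x
      = ∑' _ : children G o x, (K : ℝ≥0∞)⁻¹ ^ (G.dist o x + 1) := by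
        rw [hG.tsum_children, natCast_mul_inv_pow_succ hK]
    _ ≤ ∑' y : children G o x, coverMass G o K w y := by
        refine ENNReal.tsum_le_tsum fun y => ?_
        have hy := hcon y y.2
        rwa [(parent_spec hG.connected y.2.1).2, y.2.2] at hy
    _ ≤ coverMass G o K w x := tsum_children_coverMass_le hG.connected w x

/- Otherwise the cover has too little mass below `v`; some child inherits the deficit, and so on
down a ray. A cylinder of the cover that contains the ray has its full weight below one of the
vertices of the ray, which contradicts the deficit there. -/
theorem IsKaryTree.inv_pow_le_tsum_of_cylinder_subset (hK : K ≠ 0) (hG : IsKaryTree G o K) {v : V}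
    {w : ι → V} (h : cylinder ε v ⊆ ⋃ i, (cylinder ε (w i) : Set (Boundary G o ε))) :
    (K : ℝ≥0∞)⁻¹ ^ G.dist o v ≤ ∑' i, (K : ℝ≥0∞)⁻¹ ^ G.dist o (w i) := by
  by_contra! hlt
  obtain ⟨ζ, hζv, hζ⟩ := exists_mem_cylinder_forall_vertex (ε := ε) hG.isTree
    (fun x => coverMass G o K w x < (K : ℝ≥0∞)⁻¹ ^ G.dist o x)
    ((coverMass_le_tsum w v).trans_lt hlt) fun _ => hG.exists_child_coverMass_lt hK w
  obtain ⟨i, hi⟩ := mem_iUnion.1 (h hζv)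
  have hlevel : G.dist o v ≤ G.dist o (w i) := by
    by_contra! hi
    exact hlt.not_ge ((antitone_inv_natCast_pow hK hi.le).trans (ENNReal.le_tsum i))
  have hdeficit := hζ _ hlevel
  rw [show ζ.vertex (G.dist o (w i)) = w i from hi] at hdeficit
  exact hdeficit.not_ge (inv_pow_le_coverMass w i)

end CoverMass

section Hausdorff

variable {V : Type*} {G : SimpleGraph V} {o : V} {K : ℕ} {ε : ℝ}

/-- The Hausdorff measure of dimension `log K / ε` of the whole boundary. -/
def boundaryMass (K : ℕ) (ε : ℝ) : ℝ≥0∞ := ENNReal.ofReal (2 / ε) ^ (Real.log K / ε)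

theorem log_natCast_div_nonneg (K : ℕ) (hε : 0 < ε) : 0 ≤ Real.log K / ε :=
  div_nonneg (Real.log_natCast_nonneg K) hε.le

theorem boundaryMass_ne_top (hε : 0 < ε) : boundaryMass K ε ≠ ∞ :=
  ENNReal.rpow_ne_top_of_nonneg (log_natCast_div_nonneg K hε) ENNReal.ofReal_ne_top

theorem boundaryMass_ne_zero (hε : 0 < ε) : boundaryMass K ε ≠ 0 :=
  (ENNReal.rpow_pos (ENNReal.ofReal_pos.2 (by positivity)) ENNReal.ofReal_ne_top).ne'

theorem ofReal_visualRadius_rpow (hK : K ≠ 0) (hε : 0 < ε) (n : ℕ) :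
    ENNReal.ofReal (visualRadius ε n) ^ (Real.log K / ε) =
      boundaryMass K ε * (K : ℝ≥0∞)⁻¹ ^ n := by
  rw [visualRadius, ENNReal.ofReal_mul (by positivity),
    ENNReal.mul_rpow_of_nonneg _ _ (log_natCast_div_nonneg K hε), boundaryMass,
    ENNReal.ofReal_rpow_of_pos (Real.exp_pos _), ← Real.exp_mul,
    show -ε * n * (Real.log K / ε) = -(n * Real.log K) by field_simp,
    Real.exp_neg, ENNReal.ofReal_inv_of_pos (Real.exp_pos _), ofReal_exp_natCast_mul_log hK,
    ENNReal.inv_pow]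

theorem cylinder_subset_iUnion_descendants (hT : G.IsTree) (v : V) (m : ℕ) :
    (cylinder ε v : Set (Boundary G o ε)) ⊆ ⋃ w : descendants G o m v, cylinder ε w.1 := by
  intro ζ (hζ : ζ.vertex (G.dist o v) = v)
  have hmem := ζ.vertex_mem_subtree hT (Nat.le_add_right (G.dist o v) m)
  rw [hζ] at hmem
  exact mem_iUnion.2 ⟨⟨ζ.vertex (G.dist o v + m), hmem, ζ.dist_vertex _⟩, ζ.mem_cylinder_vertex _⟩

variable [hε : Fact (0 < ε)]

theorem ediam_cylinder_le (hT : G.IsTree) (v : V) :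
    Metric.ediam (cylinder ε v : Set (Boundary G o ε)) ≤
      ENNReal.ofReal (visualRadius ε (G.dist o v)) := by
  refine Metric.ediam_le fun ζ hζ ξ hξ => ?_
  rw [edist_dist]
  exact ENNReal.ofReal_le_ofReal
    ((Boundary.dist_le_visualRadius_iff hT).2 (Eq.trans hζ (Eq.symm hξ)))

theorem ediam_cylinder_rpow_le (hK : K ≠ 0) (hT : G.IsTree) (v : V) :
    Metric.ediam (cylinder ε v : Set (Boundary G o ε)) ^ (Real.log K / ε) ≤
      boundaryMass K ε * (K : ℝ≥0∞)⁻¹ ^ G.dist o v := by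
  rw [← ofReal_visualRadius_rpow hK hε.out]
  exact ENNReal.rpow_le_rpow (ediam_cylinder_le hT v) (log_natCast_div_nonneg K hε.out)

theorem IsKaryTree.tsum_descendants_ediam_rpow_le (hK : K ≠ 0) (hG : IsKaryTree G o K) (m : ℕ)
    (v : V) :
    ∑' w : descendants G o m v, Metric.ediam (cylinder ε w.1 : Set (Boundary G o ε)) ^
      (Real.log K / ε) ≤ boundaryMass K ε * (K : ℝ≥0∞)⁻¹ ^ G.dist o v :=
  calc ∑' w : descendants G o m v, Metric.ediam (cylinder ε w.1 : Set (Boundary G o ε)) ^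
        (Real.log K / ε)
      ≤ ∑' _ : descendants G o m v,
          boundaryMass K ε * (K : ℝ≥0∞)⁻¹ ^ (G.dist o v + m) :=
        ENNReal.tsum_le_tsum fun w => w.2.2 ▸ ediam_cylinder_rpow_le hK hG.isTree w.1
    _ = boundaryMass K ε * (K : ℝ≥0∞)⁻¹ ^ G.dist o v * ((K : ℝ≥0∞) ^ m * (K : ℝ≥0∞)⁻¹ ^ m) := by
        rw [hG.tsum_descendants, pow_add]
        ring
    _ = boundaryMass K ε * (K : ℝ≥0∞)⁻¹ ^ G.dist o v := by
        rw [natCast_pow_mul_inv_pow hK, mul_one]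

theorem IsKaryTree.hausdorffMeasure_cylinder_le (hK : K ≠ 0) (hG : IsKaryTree G o K) (v : V) :
    Measure.hausdorffMeasure (Real.log K / ε) (cylinder ε v : Set (Boundary G o ε)) ≤
      boundaryMass K ε * (K : ℝ≥0∞)⁻¹ ^ G.dist o v := by
  have := hG.countable
  have hradius : Tendsto (fun m => ENNReal.ofReal (visualRadius ε (G.dist o v + m))) atTop
      (𝓝 0) := by
    rw [← ENNReal.ofReal_zero]
    exact ENNReal.tendsto_ofReal ((tendsto_visualRadius hε.out).comp
      (tendsto_atTop_mono (fun m => Nat.le_add_left m _) tendsto_id))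
  refine (Measure.hausdorffMeasure_le_liminf_tsum (ι := fun m => descendants G o m v) _ _ _ hradius
    (fun m w => cylinder ε w.1)
    (Eventually.of_forall fun m w => w.2.2 ▸ ediam_cylinder_le hG.isTree w.1)
    (Eventually.of_forall fun m => cylinder_subset_iUnion_descendants hG.isTree v m)).trans ?_
  exact (liminf_le_liminf (Eventually.of_forall fun m =>
    hG.tsum_descendants_ediam_rpow_le hK m v)).trans_eq (liminf_const _)

theorem exists_subset_cylinder_of_nontrivial (hT : G.IsTree) {t : Set (Boundary G o ε)}
    (ht : t.Nontrivial) :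
    ∃ w : V, t ⊆ cylinder ε w ∧ ENNReal.ofReal (visualRadius ε (G.dist o w)) ≤ Metric.ediam t := by
  classical
  obtain ⟨ζ, hζ, ξ, hξ, hne⟩ := ht
  have hex : ∃ n, ∃ η ∈ t, ζ ≠ η ∧ ζ.level η = n := ⟨_, ξ, hξ, hne, rfl⟩
  obtain ⟨η, hη, hne', hlevel⟩ := Nat.find_spec hex
  refine ⟨ζ.vertex (Nat.find hex), fun x hx => mem_cylinder_vertex_iff.2 ?_, ?_⟩
  · rcases eq_or_ne ζ x with rfl | hxζ
    · rfl
    · exact ((Boundary.le_level_iff hT hxζ).1 (Nat.find_min' hex ⟨x, hx, hxζ, rfl⟩)).symm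
  · rw [ζ.dist_vertex, ← hlevel, ← Boundary.dist_of_ne_eq_visualRadius hne', ← edist_dist]
    exact Metric.edist_le_ediam_of_mem hζ hη

theorem IsKaryTree.exists_subset_cylinder (hK : 2 ≤ K) (hG : IsKaryTree G o K)
    (t : Set (Boundary G o ε)) {δ : ℝ≥0∞} (hδ : 0 < δ) :
    ∃ w : V, t ⊆ cylinder ε w ∧ boundaryMass K ε * (K : ℝ≥0∞)⁻¹ ^ G.dist o w ≤
      (⨆ _ : t.Nonempty, Metric.ediam t ^ (Real.log K / ε)) + δ := by
  have hK0 : K ≠ 0 := by omega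
  rcases t.subsingleton_or_nontrivial with ht | ht
  · have hlim := ENNReal.Tendsto.const_mul (a := boundaryMass K ε)
      (ENNReal.tendsto_pow_atTop_nhds_zero_of_lt_one
        (ENNReal.inv_lt_one.2 (by exact_mod_cast hK : (1 : ℝ≥0∞) < K)))
      (Or.inr (boundaryMass_ne_top hε.out))
    rw [mul_zero] at hlim
    obtain ⟨n, hn⟩ := (hlim.eventually (gt_mem_nhds hδ)).exists
    obtain ⟨ζ, hζ⟩ : ∃ ζ, t ⊆ {ζ} := by
      rcases ht.eq_empty_or_singleton with rfl | ⟨ζ, rfl⟩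
      · obtain ⟨ζ, -⟩ := exists_forall_vertex (ε := ε) hG.isTree (fun _ => True) trivial
          fun v _ => (hG.children_nonempty hK0 v).imp fun _ h => ⟨h, trivial⟩
        exact ⟨ζ, empty_subset _⟩
      · exact ⟨ζ, subset_rfl⟩
    refine ⟨ζ.vertex n, hζ.trans (singleton_subset_iff.2 (ζ.mem_cylinder_vertex n)), ?_⟩
    rw [ζ.dist_vertex]
    exact hn.le.trans le_add_self
  · obtain ⟨w, hw, hle⟩ := exists_subset_cylinder_of_nontrivial hG.isTree ht
    refine ⟨w, hw, le_add_right ?_⟩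
    rw [iSup_pos ht.nonempty, ← ofReal_visualRadius_rpow hK0 hε.out]
    exact ENNReal.rpow_le_rpow hle (log_natCast_div_nonneg K hε.out)

theorem IsKaryTree.hausdorffMeasure_cylinder (hK : 2 ≤ K) (hG : IsKaryTree G o K) (v : V) :
    Measure.hausdorffMeasure (Real.log K / ε) (cylinder ε v : Set (Boundary G o ε)) =
      boundaryMass K ε * (K : ℝ≥0∞)⁻¹ ^ G.dist o v := by
  have hK0 : K ≠ 0 := by omega
  refine (hG.hausdorffMeasure_cylinder_le hK0 v).antisymm ?_
  rw [Measure.hausdorffMeasure_apply]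
  refine le_trans ?_ (le_iSup₂ (1 : ℝ≥0∞) one_pos)
  refine le_iInf₂ fun t ht => le_iInf fun _ => ?_
  refine ENNReal.le_of_forall_pos_le_add fun δ hδ _ => ?_
  obtain ⟨δ', hδ', hsum⟩ := ENNReal.exists_pos_sum_of_countable' (ε := (δ : ℝ≥0∞))
    (by exact_mod_cast hδ.ne') ℕ
  choose w hw hle using fun i => hG.exists_subset_cylinder hK (t i) (hδ' i)
  calc boundaryMass K ε * (K : ℝ≥0∞)⁻¹ ^ G.dist o v
      ≤ boundaryMass K ε * ∑' i, (K : ℝ≥0∞)⁻¹ ^ G.dist o (w i) := by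
        gcongr
        exact hG.inv_pow_le_tsum_of_cylinder_subset hK0 (ht.trans (iUnion_mono hw))
    _ = ∑' i, boundaryMass K ε * (K : ℝ≥0∞)⁻¹ ^ G.dist o (w i) := ENNReal.tsum_mul_left.symm
    _ ≤ ∑' i, ((⨆ _ : (t i).Nonempty, Metric.ediam (t i) ^ (Real.log K / ε)) + δ' i) :=
        ENNReal.tsum_le_tsum hle
    _ ≤ ∑' i, (⨆ _ : (t i).Nonempty, Metric.ediam (t i) ^ (Real.log K / ε)) + δ := by
        rw [ENNReal.tsum_add]
        gcongr

theorem IsKaryTree.boundaryMeasure_cylinder (hK : 2 ≤ K) (hG : IsKaryTree G o K) (v : V) :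
    boundaryMeasure G o K ε (cylinder ε v) = (K : ℝ≥0∞)⁻¹ ^ G.dist o v := by
  rw [boundaryMeasure, Measure.smul_apply, ← cylinder_root, hG.hausdorffMeasure_cylinder hK,
    hG.hausdorffMeasure_cylinder hK, SimpleGraph.dist_self, pow_zero, mul_one, smul_eq_mul,
    ← mul_assoc, ENNReal.inv_mul_cancel (boundaryMass_ne_zero hε.out)
      (boundaryMass_ne_top hε.out), one_mul]

theorem IsKaryTree.isProbabilityMeasure_boundaryMeasure (hK : 2 ≤ K) (hG : IsKaryTree G o K) :
    IsProbabilityMeasure (boundaryMeasure G o K ε) :=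
  ⟨by rw [← cylinder_root, hG.boundaryMeasure_cylinder hK, SimpleGraph.dist_self, pow_zero]⟩

end Hausdorff

section Disintegration

variable {V : Type*} {G : SimpleGraph V} {o : V} {K : ℕ} {ε : ℝ} [Fact (0 < ε)]

theorem IsKaryTree.lintegral_eq_tsum_cylinder (hG : IsKaryTree G o K) (n : ℕ)
    (h : Boundary G o ε → ℝ≥0∞) (μ : Measure (Boundary G o ε)) :
    ∫⁻ ζ, h ζ ∂μ = ∑' v : {v | G.dist o v = n}, ∫⁻ ζ in cylinder ε v.1, h ζ ∂μ := by
  have := hG.countable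
  have huniv : ⋃ v : {v | G.dist o v = n}, (cylinder ε v.1 : Set (Boundary G o ε)) = univ :=
    eq_univ_of_forall fun ζ =>
      mem_iUnion.2 ⟨⟨ζ.vertex n, ζ.dist_vertex n⟩, ζ.mem_cylinder_vertex n⟩
  rw [← lintegral_iUnion (fun v => measurableSet_cylinder hG.isTree _), huniv, setLIntegral_univ]
  rintro ⟨v, rfl⟩ ⟨w, hw⟩ hne
  refine disjoint_left.2 fun ζ (hζ : _ = v) (hζ' : _ = w) => hne (Subtype.ext ?_)
  have hw : G.dist o w = G.dist o v := hw
  rw [hw] at hζ'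
  exact hζ.symm.trans hζ'

theorem IsKaryTree.neZero_restrict_cylinder (hK : 2 ≤ K) (hG : IsKaryTree G o K) (v : V) :
    NeZero ((boundaryMeasure G o K ε).restrict (cylinder ε v)) := by
  refine ⟨fun h0 => pow_ne_zero (G.dist o v) (ENNReal.inv_ne_zero.2 (ENNReal.natCast_ne_top K)) ?_⟩
  rw [← hG.boundaryMeasure_cylinder (ε := ε) hK, Measure.restrict_eq_zero.1 h0]

theorem IsKaryTree.setLIntegral_cylinder_comp_vertex (hK : 2 ≤ K) (hG : IsKaryTree G o K) (v : V)
    (h : V → ℝ≥0∞) :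
    ∫⁻ ζ in cylinder ε v, h (ζ.vertex (G.dist o v)) ∂boundaryMeasure G o K ε =
      (K : ℝ≥0∞)⁻¹ ^ G.dist o v * h v := by
  rw [setLIntegral_congr_fun (g := fun _ => h v) (measurableSet_cylinder hG.isTree v)
    (fun ζ (hζ : _ = v) => by rw [hζ]), setLIntegral_const, hG.boundaryMeasure_cylinder hK,
    mul_comm]

theorem IsKaryTree.lintegral_comp_vertex (hK : 2 ≤ K) (hG : IsKaryTree G o K) (n : ℕ)
    (h : V → ℝ≥0∞) :
    ∫⁻ ζ : Boundary G o ε, h (ζ.vertex n) ∂boundaryMeasure G o K ε =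
      ∑' v : {v | G.dist o v = n}, (K : ℝ≥0∞)⁻¹ ^ n * h v := by
  rw [hG.lintegral_eq_tsum_cylinder n]
  refine tsum_congr ?_
  rintro ⟨v, rfl⟩
  exact hG.setLIntegral_cylinder_comp_vertex hK v h

theorem IsKaryTree.lintegral_laverage_cylinder (hK : 2 ≤ K) (hG : IsKaryTree G o K) (n : ℕ)
    (h : Boundary G o ε → ℝ≥0∞) :
    ∫⁻ ζ, (⨍⁻ ξ in cylinder ε (ζ.vertex n), h ξ ∂boundaryMeasure G o K ε)
      ∂boundaryMeasure G o K ε = ∫⁻ ζ, h ζ ∂boundaryMeasure G o K ε := by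
  rw [hG.lintegral_comp_vertex hK n fun v => ⨍⁻ ξ in cylinder ε v, h ξ ∂boundaryMeasure G o K ε,
    hG.lintegral_eq_tsum_cylinder n]
  refine tsum_congr ?_
  rintro ⟨v, rfl⟩
  rw [setLAverage_eq, hG.boundaryMeasure_cylinder hK, ENNReal.mul_div_cancel (by simp)]
  exact ENNReal.pow_ne_top (ENNReal.inv_ne_top.2 (by exact_mod_cast (by omega : K ≠ 0)))

end Disintegration

/-! ### Inequalities for integrals and series -/

section Inequalities

theorem ofReal_abs_sub_eq_edist (x y : ℝ) : ENNReal.ofReal |x - y| = edist x y := by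
  rw [edist_dist, Real.dist_eq]

theorem rpow_sub_one_mul_self {p : ℝ} (hp : 1 ≤ p) (x : ℝ≥0∞) : x ^ (p - 1) * x = x ^ p := by
  conv_rhs => rw [← sub_add_cancel p 1,
    ENNReal.rpow_add_of_nonneg _ _ (by linarith) zero_le_one, ENNReal.rpow_one]

theorem lintegral_rpow_le {Ω : Type*} [MeasurableSpace Ω] {μ : Measure Ω} {p : ℝ} (hp : 1 ≤ p)
    {f : Ω → ℝ≥0∞} (hf : AEMeasurable f μ) :
    (∫⁻ x, f x ∂μ) ^ p ≤ μ univ ^ (p - 1) * ∫⁻ x, f x ^ p ∂μ := by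
  rcases hp.eq_or_lt with rfl | hp
  · simp
  have hp0 : p ≠ 0 := by linarith
  have hp1 : p - 1 ≠ 0 := by linarith
  have hHolder := ENNReal.lintegral_mul_le_Lp_mul_Lq μ (.conjExponent hp) hf
    (g := fun _ => 1) aemeasurable_const
  simp only [Pi.mul_apply, mul_one, ENNReal.one_rpow, lintegral_const, one_mul] at hHolder
  calc (∫⁻ x, f x ∂μ) ^ p
      ≤ ((∫⁻ x, f x ^ p ∂μ) ^ (1 / p) * μ univ ^ (1 / p.conjExponent)) ^ p :=
        ENNReal.rpow_le_rpow hHolder (by linarith)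
    _ = μ univ ^ (1 / p.conjExponent * p) * (∫⁻ x, f x ^ p ∂μ) ^ (1 / p * p) := by
        rw [ENNReal.mul_rpow_of_nonneg _ _ (by linarith), ← ENNReal.rpow_mul, ← ENNReal.rpow_mul,
          mul_comm]
    _ = μ univ ^ (p - 1) * ∫⁻ x, f x ^ p ∂μ := by
        rw [one_div_mul_cancel hp0, ENNReal.rpow_one,
          show 1 / p.conjExponent * p = p - 1 by rw [Real.conjExponent]; field_simp]

theorem lintegral_rpow_le_of_isProbabilityMeasure {Ω : Type*} [MeasurableSpace Ω] {μ : Measure Ω}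
    [IsProbabilityMeasure μ] {p : ℝ} (hp : 1 ≤ p) {f : Ω → ℝ≥0∞} (hf : AEMeasurable f μ) :
    (∫⁻ x, f x ∂μ) ^ p ≤ ∫⁻ x, f x ^ p ∂μ := by
  simpa using lintegral_rpow_le hp hf

theorem enorm_average_rpow_le {Ω E : Type*} [MeasurableSpace Ω] [NormedAddCommGroup E]
    [NormedSpace ℝ E] {μ : Measure Ω} [IsFiniteMeasure μ] [NeZero μ] {p : ℝ} (hp : 1 ≤ p)
    {u : Ω → E} (hu : AEStronglyMeasurable u μ) : ‖⨍ x, u x ∂μ‖ₑ ^ p ≤ ⨍⁻ x, ‖u x‖ₑ ^ p ∂μ :=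
  (ENNReal.rpow_le_rpow (enorm_integral_le_lintegral_enorm u) (by linarith)).trans
    (lintegral_rpow_le_of_isProbabilityMeasure hp (hu.enorm.smul_measure _))

theorem edist_average_rpow_le {Ω E : Type*} [MeasurableSpace Ω] [NormedAddCommGroup E]
    [NormedSpace ℝ E] [CompleteSpace E] {μ : Measure Ω} [IsFiniteMeasure μ] [NeZero μ] {p : ℝ}
    (hp : 1 ≤ p) {u : Ω → E} (hu : Integrable u μ) (c : E) :
    edist c (⨍ x, u x ∂μ) ^ p ≤ ⨍⁻ x, edist c (u x) ^ p ∂μ := by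
  have hsub : c - ⨍ x, u x ∂μ = ⨍ x, (c - u x) ∂μ := by
    rw [average, average, integral_sub (integrable_const c) hu.to_average, integral_const,
      probReal_univ, one_smul]
  simp only [edist_eq_enorm_sub, hsub]
  exact enorm_average_rpow_le hp (aestronglyMeasurable_const.sub hu.aestronglyMeasurable)

theorem ae_tendsto_of_tsum_lintegral_edist_rpow_ne_top {Ω E : Type*} [MeasurableSpace Ω]
    [PseudoEMetricSpace E] {μ : Measure Ω} {p : ℝ} (hp : 0 < p) {f : Ω → E} {F : ℕ → Ω → E}
    (hm : ∀ n, AEMeasurable (fun x => edist (f x) (F n x) ^ p) μ)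
    (h : ∑' n, ∫⁻ x, edist (f x) (F n x) ^ p ∂μ ≠ ∞) :
    ∀ᵐ x ∂μ, Tendsto (fun n => F n x) atTop (𝓝 (f x)) := by
  rw [← lintegral_tsum hm] at h
  filter_upwards [ae_lt_top' (AEMeasurable.tsum hm) h] with x hx
  have hroot := (ENNReal.tendsto_atTop_zero_of_tsum_ne_top hx.ne).ennrpow_const p⁻¹
  simp only [ENNReal.zero_rpow_of_pos (inv_pos.2 hp), ENNReal.rpow_rpow_inv hp.ne'] at hroot
  simpa only [tendsto_iff_edist_tendsto_0, edist_comm] using hroot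

theorem tsum_mul_rpow_le {p : ℝ} (hp : 1 ≤ p) (w f : ℕ → ℝ≥0∞) :
    (∑' j, w j * f j) ^ p ≤ (∑' j, w j) ^ (p - 1) * ∑' j, w j * f j ^ p := by
  have h := lintegral_rpow_le (μ := Measure.sum fun j : ℕ => w j • Measure.dirac j) hp (f := f)
    measurable_from_top.aemeasurable
  simpa [lintegral_sum_measure, Measure.sum_apply] using h

theorem tsum_tail_rpow_le {p : ℝ} (hp : 1 ≤ p) {r : ℝ≥0∞} (hr0 : r ≠ 0) (hr : r ≠ ∞)
    (b : ℕ → ℝ≥0∞) :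
    (∑' j, b j) ^ p ≤ (∑' j, r ^ j) ^ (p - 1) * ∑' j, r ^ j * ((r⁻¹ ^ p) ^ j * b j ^ p) := by
  have hcancel (j : ℕ) : r ^ j * (r⁻¹ ^ j * b j) = b j := by
    rw [← mul_assoc, ← mul_pow, ENNReal.mul_inv_cancel hr0 hr, one_pow, one_mul]
  have hpow (j : ℕ) : (r⁻¹ ^ j * b j) ^ p = (r⁻¹ ^ p) ^ j * b j ^ p := by
    rw [ENNReal.mul_rpow_of_nonneg _ _ (by linarith), ← ENNReal.rpow_natCast_mul, mul_comm (j : ℝ),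
      ENNReal.rpow_mul_natCast]
  simpa only [hcancel, hpow] using tsum_mul_rpow_le hp (fun j => r ^ j) fun j => r⁻¹ ^ j * b j

/- A discrete Hardy inequality: Jensen's inequality with the weights `r ^ j`, then summation over
the diagonals `n + j`. -/
theorem tsum_mul_tsum_add_rpow_le {p : ℝ} (hp : 1 ≤ p) {r : ℝ≥0∞} (hr0 : r ≠ 0) (hr : r ≠ ∞)
    (b : ℕ → ℝ≥0∞) :
    ∑' n, (r⁻¹ ^ p) ^ n * (∑' j, b (n + j)) ^ p ≤
      (∑' j, r ^ j) ^ p * ∑' n, (r⁻¹ ^ p) ^ n * b n ^ p :=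
  calc ∑' n, (r⁻¹ ^ p) ^ n * (∑' j, b (n + j)) ^ p
      ≤ ∑' n, (r⁻¹ ^ p) ^ n * ((∑' j, r ^ j) ^ (p - 1) *
          ∑' j, r ^ j * ((r⁻¹ ^ p) ^ j * b (n + j) ^ p)) :=
        ENNReal.tsum_le_tsum fun n => by
          gcongr
          exact tsum_tail_rpow_le hp hr0 hr fun j => b (n + j)
    _ = (∑' j, r ^ j) ^ (p - 1) *
          ∑' j, r ^ j * ∑' n, (r⁻¹ ^ p) ^ (n + j) * b (n + j) ^ p := by
        simp only [← ENNReal.tsum_mul_left]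
        rw [ENNReal.tsum_comm]
        refine tsum_congr fun j => tsum_congr fun n => ?_
        rw [pow_add]
        ring
    _ ≤ (∑' j, r ^ j) ^ (p - 1) * ∑' j, r ^ j * ∑' n, (r⁻¹ ^ p) ^ n * b n ^ p := by
        refine mul_le_mul' le_rfl (ENNReal.tsum_le_tsum fun j => mul_le_mul' le_rfl ?_)
        exact ENNReal.tsum_comp_le_tsum_of_injective (add_left_injective j)
          fun n => (r⁻¹ ^ p) ^ n * b n ^ p
    _ = (∑' j, r ^ j) ^ p * ∑' n, (r⁻¹ ^ p) ^ n * b n ^ p := by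
        rw [ENNReal.tsum_mul_right, ← mul_assoc, rpow_sub_one_mul_self hp]

theorem tsum_mul_lintegral_tsum_add_rpow_le {Ω : Type*} [MeasurableSpace Ω] (μ : Measure Ω) {p : ℝ}
    (hp : 1 ≤ p) {r : ℝ≥0∞} (hr0 : r ≠ 0) (hr : r ≠ ∞) {b : ℕ → Ω → ℝ≥0∞}
    (hb : ∀ n, Measurable (b n)) :
    ∑' n, (r⁻¹ ^ p) ^ n * ∫⁻ x, (∑' j, b (n + j) x) ^ p ∂μ ≤
      (∑' j, r ^ j) ^ p * ∑' n, (r⁻¹ ^ p) ^ n * ∫⁻ x, b n x ^ p ∂μ := by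
  have hb' (n : ℕ) : Measurable fun x => ∑' j, b (n + j) x := Measurable.tsum fun j => hb (n + j)
  have hswap {F : ℕ → Ω → ℝ≥0∞} (hF : ∀ n, Measurable (F n)) :
      ∑' n, (r⁻¹ ^ p) ^ n * ∫⁻ x, F n x ∂μ = ∫⁻ x, ∑' n, (r⁻¹ ^ p) ^ n * F n x ∂μ := by
    rw [lintegral_tsum fun n => ((hF n).const_mul _).aemeasurable]
    exact tsum_congr fun n => (lintegral_const_mul _ (hF n)).symm
  rw [hswap fun n => (hb' n).pow_const p, hswap fun n => (hb n).pow_const p,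
    ← lintegral_const_mul _ (by fun_prop)]
  exact lintegral_mono fun x => tsum_mul_tsum_add_rpow_le hp hr0 hr fun n => b n x

theorem inv_ofReal_exp_neg_rpow_pow (s p : ℝ) (n : ℕ) :
    ((ENNReal.ofReal (Real.exp (-s)))⁻¹ ^ p) ^ n = ENNReal.ofReal (Real.exp (s * p * n)) := by
  rw [← ENNReal.ofReal_inv_of_pos (Real.exp_pos _), ← Real.exp_neg, neg_neg,
    ENNReal.ofReal_rpow_of_pos (Real.exp_pos _), ← Real.exp_mul,
    ← ENNReal.ofReal_pow (Real.exp_pos _).le, ← Real.exp_nat_mul, mul_comm (n : ℝ)]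

theorem tsum_ofReal_exp_neg_pow_ne_top {s : ℝ} (hs : 0 < s) :
    ∑' j : ℕ, ENNReal.ofReal (Real.exp (-s)) ^ j ≠ ∞ := by
  rw [ENNReal.tsum_geometric, ENNReal.inv_ne_top, Ne, tsub_eq_zero_iff_le, not_le,
    ENNReal.ofReal_lt_one, Real.exp_lt_one_iff, neg_lt_zero]
  exact hs

theorem enorm_add_rpow_le {p : ℝ} (hp : 1 ≤ p) {a b : ℝ} {t : ℝ≥0∞} (h : edist a b ≤ t) :
    ‖b‖ₑ ^ p ≤ 2 ^ (p - 1) * (‖a‖ₑ ^ p + t ^ p) := by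
  refine (ENNReal.rpow_le_rpow ?_ (by linarith)).trans
    (ENNReal.rpow_add_le_mul_rpow_add_rpow _ _ hp)
  have htri := edist_triangle_left b 0 a
  rw [edist_zero_right, edist_zero_right, add_comm] at htri
  exact htri.trans (by gcongr)

theorem laverage_abs_sub_rpow_le {Ω : Type*} [MeasurableSpace Ω] {μ : Measure Ω}
    [IsFiniteMeasure μ] [NeZero μ] {p : ℝ} (hp : 1 ≤ p) {u : Ω → ℝ} {T : Ω → ℝ≥0∞} {a c : ℝ}
    {t : ℝ≥0∞} (ha : edist c a ≤ t) (hu : ∀ᵐ x ∂μ, edist c (u x) ≤ T x) :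
    ⨍⁻ x, ENNReal.ofReal |a - u x| ^ p ∂μ ≤ 2 ^ (p - 1) * (t ^ p + ⨍⁻ x, T x ^ p ∂μ) := by
  have hbound : ∀ᵐ x ∂(μ univ)⁻¹ • μ,
      ENNReal.ofReal |a - u x| ^ p ≤ 2 ^ (p - 1) * (t ^ p + T x ^ p) := by
    refine Measure.ae_smul_measure (hu.mono fun x hx => ?_) _
    refine (ENNReal.rpow_le_rpow ?_ (by linarith)).trans
      (ENNReal.rpow_add_le_mul_rpow_add_rpow _ _ hp)
    rw [ofReal_abs_sub_eq_edist]
    exact (edist_triangle_left _ _ c).trans (add_le_add ha hx)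
  refine (lintegral_mono_ae hbound).trans_eq ?_
  rw [lintegral_const_mul' _ _ (ENNReal.rpow_ne_top_of_nonneg (by linarith) (by simp)),
    lintegral_add_left measurable_const, lintegral_const, measure_univ, mul_one, laverage]

theorem lintegral_Ioi_rpow {a c : ℝ} (ha : 0 < a) (hc : 0 < c) :
    ∫⁻ t in Ioi c, ENNReal.ofReal (t ^ (-a - 1)) = ENNReal.ofReal (c ^ (-a) / a) := by
  rw [← ofReal_integral_eq_lintegral_ofReal (integrableOn_Ioi_rpow_of_lt (by linarith) hc),
    integral_Ioi_rpow_of_lt (by linarith) hc, sub_add_cancel, neg_div_neg_eq]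
  filter_upwards [ae_restrict_mem measurableSet_Ioi] with t ht
  exact Real.rpow_nonneg (hc.trans ht).le _

theorem lintegral_Ioc_rpow {a b c : ℝ} (ha : 0 < a) (hc : 0 < c) (hcb : c ≤ b) :
    ∫⁻ t in Ioc c b, ENNReal.ofReal (t ^ (-a - 1)) =
      ENNReal.ofReal ((c ^ (-a) - b ^ (-a)) / a) := by
  have hadd := lintegral_inter_add_sdiff (μ := volume)
    (fun t : ℝ => ENNReal.ofReal (t ^ (-a - 1))) (Ioi c) (measurableSet_Ioi (a := b))
  rw [inter_eq_right.2 (Ioi_subset_Ioi hcb), Ioi_sdiff_Ioi, lintegral_Ioi_rpow ha hc,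
    lintegral_Ioi_rpow ha (hc.trans_le hcb)] at hadd
  rw [sub_div, ENNReal.ofReal_sub _ (by have := hc.trans_le hcb; positivity), ← hadd,
    ENNReal.add_sub_cancel_left ENNReal.ofReal_ne_top]

end Inequalities

/-! ### Points and edges of the metric tree -/

section Points

variable {V : Type*} {G : SimpleGraph V} {o v : V} {x y z : Point G o}

theorem Point.dist_le_of_height_le (h : x.height ≤ y.height) :
    G.dist o x.vert ≤ G.dist o y.vert := by
  rw [← x.ceil_height, ← y.ceil_height]
  exact Nat.ceil_mono h

theorem Point.height_le (x : Point G o) : x.height ≤ G.dist o x.vert := by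
  rw [← x.ceil_height]
  exact Nat.le_ceil _

theorem Point.lt_height (x : Point G o) : (G.dist o x.vert : ℝ) - 1 < x.height := by
  rw [← x.ceil_height, sub_lt_iff_lt_add]
  exact Nat.ceil_lt_add_one x.height_nonneg

theorem Point.anc_iff (hT : G.IsTree) :
    x.Anc y ↔ x.height ≤ y.height ∧ y.vert ∈ subtree G o x.vert :=
  and_congr_right fun _ => (mem_subtree_iff hT).symm

theorem Point.Anc.refl (x : Point G o) : x.Anc x := ⟨le_rfl, by simp⟩

theorem Point.Anc.trans (hT : G.IsTree) (h : x.Anc y) (h' : y.Anc z) : x.Anc z := by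
  rw [Point.anc_iff hT] at *
  exact ⟨h.1.trans h'.1, subtree_subset_subtree hT.connected h.2 h'.2⟩

theorem Point.Anc.of_height_le (hT : G.IsTree) (h : x.Anc z) (h' : y.Anc z)
    (hxy : x.height ≤ y.height) : x.Anc y := by
  rw [Point.anc_iff hT] at *
  exact ⟨hxy, mem_subtree_of_mem_subtree hT.connected h.2 h'.2 (Point.dist_le_of_height_le hxy)⟩

theorem Point.Anc.vert_eq (h : x.Anc y) (hd : G.dist o x.vert = G.dist o y.vert)
    (hT : G.IsTree) : x.vert = y.vert :=
  eq_of_mem_subtree ((Point.anc_iff hT).1 h).2 (self_mem_subtree _) hd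

/-- The geodesic from the root to `x`. -/
def segment (x : Point G o) : Set (Point G o) := {z | z.Anc x}

/-- The part of the geodesic from the root to `x` that lies on the edge of `x`. -/
def lastEdge (x : Point G o) : Set (Point G o) := {z | z.vert = x.vert ∧ z.height ≤ x.height}

/-- The vertex `v`, as a point of the metric tree. -/
def vertexPoint (G : SimpleGraph V) (o v : V) : Point G o :=
  ⟨v, G.dist o v, Nat.cast_nonneg _, Nat.ceil_natCast _⟩

theorem vertexPoint_parent_anc (hT : G.IsTree) (hx : x.vert ≠ o) :
    (vertexPoint G o (parent G o x.vert)).Anc x := by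
  refine (Point.anc_iff hT).2 ⟨?_, mem_subtree_parent hT.connected _⟩
  have h := x.lt_height
  rw [(parent_spec hT.connected hx).2, Nat.cast_add_one, add_sub_cancel_right] at h
  exact h.le

theorem segment_eq_union (hT : G.IsTree) (hx : x.vert ≠ o) :
    segment x = segment (vertexPoint G o (parent G o x.vert)) ∪ lastEdge x := by
  have hpx := vertexPoint_parent_anc hT hx
  refine Subset.antisymm (fun z (hz : z.Anc x) => ?_) (union_subset ?_ ?_)
  · rcases le_or_gt z.height (G.dist o (parent G o x.vert)) with h | h
    · exact Or.inl (hz.of_height_le hT hpx h)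
    · have hlt : G.dist o (parent G o x.vert) < G.dist o z.vert := by
        exact_mod_cast h.trans_le z.height_le
      have hle := Point.dist_le_of_height_le hz.1
      have hd := (parent_spec hT.connected hx).2
      exact Or.inr ⟨hz.vert_eq (by omega) hT, hz.1⟩
  · exact fun z hz => Point.Anc.trans hT hz hpx
  · rintro z ⟨hz, hle⟩
    exact ⟨hle, by simp [hz]⟩

theorem disjoint_segment_lastEdge (hG : G.Connected) (hx : x.vert ≠ o) :
    Disjoint (segment (vertexPoint G o (parent G o x.vert))) (lastEdge x) := by
  refine Set.disjoint_left.2 fun z hz hz' => ?_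
  have hle : z.height ≤ G.dist o (parent G o x.vert) := hz.1
  have hlt := z.lt_height
  rw [hz'.1, (parent_spec hG hx).2, Nat.cast_add_one, add_sub_cancel_right] at hlt
  exact hlt.not_ge hle

theorem sdiff_segment_subset_geodesic (hT : G.IsTree) (x y : Point G o) :
    segment x \ segment y ⊆ geodesic x y := by
  refine fun z ⟨hx, hy⟩ => ⟨Or.inl hx, fun w hwx hwy => ?_⟩
  rcases le_total w.height z.height with h | h
  · exact hwx.of_height_le hT hx h
  · exact absurd ((Point.Anc.of_height_le hT hx hwx h).trans hT hwy) hy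

theorem geodesic_comm (x y : Point G o) : geodesic x y = geodesic y x := by
  ext z
  exact and_congr or_comm (forall_congr' fun w => forall_comm)

theorem geodesic_vertexPoint_parent_subset (hT : G.IsTree) (hx : x.vert ≠ o) :
    geodesic (vertexPoint G o (parent G o x.vert)) x ⊆
      {z | z.height = G.dist o (parent G o x.vert)} ∪ {z | z.vert = x.vert} := by
  rintro z ⟨hz, hz'⟩
  have hpx := vertexPoint_parent_anc hT hx
  have hpz := hz' _ (Point.Anc.refl _) hpx
  have hzx : z ∈ segment x := hz.elim (fun h => h.trans hT hpx) id
  rw [segment_eq_union hT hx] at hzx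
  exact hzx.imp (fun h => le_antisymm h.1 hpz.1) And.left

theorem Point.measurable_height : Measurable (Point.height : Point G o → ℝ) := by
  let _ : MeasurableSpace V := ⊤
  exact measurable_snd.comp (comap_measurable (fun x : Point G o => (x.vert, x.height)))

theorem Point.measurable_comp_vert {β : Type*} [MeasurableSpace β] (h : V → β) :
    Measurable fun x : Point G o => h x.vert := by
  let _ : MeasurableSpace V := ⊤
  exact (measurable_from_top (f := h)).comp
    (measurable_fst.comp (comap_measurable (fun x : Point G o => (x.vert, x.height))))

theorem Point.measurableSet_vert (s : Set V) : MeasurableSet {x : Point G o | x.vert ∈ s} :=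
  measurableSet_setOfPred.2 (Point.measurable_comp_vert fun v => v ∈ s)

theorem measurableSet_segment (x : Point G o) : MeasurableSet (segment x) :=
  (measurableSet_le Point.measurable_height measurable_const).inter
    (Point.measurableSet_vert {v | G.dist o v + G.dist v x.vert = G.dist o x.vert})

theorem measurableSet_lastEdge (x : Point G o) : MeasurableSet (lastEdge x) :=
  (Point.measurableSet_vert {x.vert}).inter
    (measurableSet_le Point.measurable_height measurable_const)

/-- The heights of the points on the edge that ends in `v`. -/
abbrev edgeHeights (G : SimpleGraph V) (o v : V) : Set ℝ :=
  Ioc ((G.dist o v : ℝ) - 1) (G.dist o v)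

theorem edgePoint_spec (hG : G.Connected) (hv : v ≠ o) {t : ℝ} (ht : t ∈ edgeHeights G o v) :
    (edgePoint G o v t).vert = v ∧ (edgePoint G o v t).height = t := by
  have h1 : 1 ≤ G.dist o v := hG.pos_dist_of_ne hv.symm
  have h1' : (1 : ℝ) ≤ G.dist o v := by exact_mod_cast h1
  have h : 0 ≤ t ∧ ⌈t⌉₊ = G.dist o v := by
    refine ⟨by linarith [ht.1], (Nat.ceil_eq_iff (by omega)).2 ⟨?_, ht.2⟩⟩
    rw [Nat.cast_sub h1, Nat.cast_one]
    exact ht.1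
  simp [edgePoint, h]

theorem measurable_edgePoint (v : V) : Measurable (edgePoint G o v) := by
  classical
  let _ : MeasurableSpace V := ⊤
  have hS : MeasurableSet {t : ℝ | 0 ≤ t ∧ ⌈t⌉₊ = G.dist o v} :=
    measurableSet_Ici.inter (Nat.measurable_ceil (measurableSet_singleton _))
  have heq : (fun x : Point G o => (x.vert, x.height)) ∘ edgePoint G o v =
      fun t => if 0 ≤ t ∧ ⌈t⌉₊ = G.dist o v then (v, t) else (o, 0) := by
    ext1 t
    by_cases h : 0 ≤ t ∧ ⌈t⌉₊ = G.dist o v <;> simp [edgePoint, h, Point.root]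
  rw [measurable_comap_iff, heq]
  exact Measurable.ite hS (measurable_const.prodMk measurable_id) measurable_const

end Points

/-! ### Integration over the metric tree -/

section Integration

variable {V : Type*} {G : SimpleGraph V} {o v : V} {x : Point G o} {F : Point G o → ℝ≥0∞}

/-- The integral of `F` over the edge that ends in `v`, with the weight `e^{-a|z|}`. For `a = ε`
this is an integral with respect to arc length for `d_X`, for `a = β` one with respect to `μ`. -/
def edgeIntegral (a : ℝ) (F : Point G o → ℝ≥0∞) (v : V) : ℝ≥0∞ :=
  ∫⁻ t in edgeHeights G o v, F (edgePoint G o v t) * ENNReal.ofReal (Real.exp (-a * t))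

theorem lintegral_lengthMeasure (hF : Measurable F) :
    ∫⁻ z, F z ∂lengthMeasure G o =
      ∑' v : {v : V // v ≠ o}, ∫⁻ t in edgeHeights G o v, F (edgePoint G o v t) := by
  rw [lengthMeasure, lintegral_sum_measure]
  exact tsum_congr fun v => lintegral_map hF (measurable_edgePoint v.1)

theorem setLIntegral_edge (hG : G.Connected) (hv : v ≠ o) (hF : Measurable F) :
    ∫⁻ z in {z | z.vert = v}, F z ∂lengthMeasure G o =
      ∫⁻ t in edgeHeights G o v, F (edgePoint G o v t) := by
  have hS : MeasurableSet {z : Point G o | z.vert = v} := Point.measurableSet_vert {v}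
  rw [← lintegral_indicator hS, lintegral_lengthMeasure (hF.indicator hS), tsum_eq_single ⟨v, hv⟩]
  · refine setLIntegral_congr_fun measurableSet_Ioc fun t ht => ?_
    simp [indicator, (edgePoint_spec hG hv ht).1]
  · rintro ⟨w, hw⟩ hne
    have hwv : w ≠ v := fun h => hne (Subtype.ext h)
    rw [setLIntegral_congr_fun (g := fun _ => 0) measurableSet_Ioc fun t ht => ?_, lintegral_zero]
    simp [indicator, (edgePoint_spec hG hw ht).1, hwv]

theorem setLIntegral_edge_mul_exp (hG : G.Connected) (hv : v ≠ o) (a : ℝ) (hF : Measurable F) :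
    ∫⁻ z in {z | z.vert = v}, F z * ENNReal.ofReal (Real.exp (-a * z.height)) ∂lengthMeasure G o =
      edgeIntegral a F v := by
  have hh := Point.measurable_height (G := G) (o := o)
  rw [setLIntegral_edge hG hv (by fun_prop), edgeIntegral]
  refine setLIntegral_congr_fun measurableSet_Ioc fun t ht => ?_
  simp only [(edgePoint_spec hG hv ht).2]

theorem lengthMeasure_height_eq (hG : G.Connected) (h : ℝ) :
    lengthMeasure G o {z | z.height = h} = 0 := by
  have hS : MeasurableSet {z : Point G o | z.height = h} :=
    Point.measurable_height (measurableSet_singleton h)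
  rw [← lintegral_indicator_one hS, lintegral_lengthMeasure (measurable_one.indicator hS),
    ENNReal.tsum_eq_zero]
  rintro ⟨v, hv⟩
  refine (setLIntegral_congr_fun (g := ({h} : Set ℝ).indicator 1) measurableSet_Ioc
    fun t ht => ?_).trans ?_
  · simp [indicator, (edgePoint_spec hG hv ht).2]
  · rw [lintegral_indicator_one (measurableSet_singleton h)]
    simp

theorem lengthMeasure_lastEdge (hG : G.Connected) (hx : x.vert ≠ o) :
    lengthMeasure G o (lastEdge x) = ENNReal.ofReal (x.height - (G.dist o x.vert - 1)) := by
  have hS : MeasurableSet {z : Point G o | z.height ≤ x.height} :=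
    measurableSet_le Point.measurable_height measurable_const
  have hIoc : Ioc ((G.dist o x.vert : ℝ) - 1) x.height =
      Iic x.height ∩ edgeHeights G o x.vert := by
    rw [inter_comm, Ioc_inter_Iic, min_eq_right x.height_le]
  rw [show lastEdge x = {z | z.height ≤ x.height} ∩ {z | z.vert = x.vert} from inter_comm _ _,
    ← Measure.restrict_apply hS, ← lintegral_indicator_one hS,
    setLIntegral_edge hG hx (measurable_one.indicator hS), ← Real.volume_Ioc, hIoc,
    ← Measure.restrict_apply measurableSet_Iic, ← lintegral_indicator_one measurableSet_Iic]
  refine setLIntegral_congr_fun measurableSet_Ioc fun t ht => ?_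
  simp [indicator, (edgePoint_spec hG hx ht).2]

theorem lintegral_treeMeasure_eq_tsum (hG : G.Connected) (β : ℝ) (hF : Measurable F) :
    ∫⁻ z, F z ∂treeMeasure G o β = ∑' v : {v : V // v ≠ o}, edgeIntegral β F v := by
  have hh := Point.measurable_height (G := G) (o := o)
  rw [treeMeasure, lintegral_withDensity_eq_lintegral_mul _ (by fun_prop) hF,
    lintegral_lengthMeasure (by fun_prop)]
  refine tsum_congr fun v => setLIntegral_congr_fun measurableSet_Ioc fun t ht => ?_
  simp only [Pi.mul_apply, (edgePoint_spec hG v.2 ht).2, mul_comm]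

theorem tsum_ne_root (hG : G.Connected) (F : V → ℝ≥0∞) :
    ∑' v : {v : V // v ≠ o}, F v = ∑' n : ℕ, ∑' v : {v : V | G.dist o v = n + 1}, F v := by
  have hU : {v : V | v ≠ o} = ⋃ n : ℕ, {v | G.dist o v = n + 1} := by
    ext v
    rw [mem_iUnion]
    exact ⟨fun hv => ⟨_, (parent_spec hG hv).2⟩, fun ⟨_, hn⟩ => ne_root_of_dist hn⟩
  have hd : univ.PairwiseDisjoint fun n : ℕ => {v : V | G.dist o v = n + 1} :=
    fun m _ n _ hmn => Set.disjoint_left.2 fun v (hm : _ = _) (hn : _ = _) => hmn (by omega)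
  rw [← ENNReal.tsum_biUnion hd, ← hU]
  rfl

theorem IsKaryTree.lintegral_treeMeasure {K : ℕ} {ε : ℝ} [Fact (0 < ε)] (hK : 2 ≤ K)
    (hG : IsKaryTree G o K) (β : ℝ) (hF : Measurable F) :
    ∫⁻ z, F z ∂treeMeasure G o β = ∑' n : ℕ, (K : ℝ≥0∞) ^ (n + 1) *
      ∫⁻ ζ : Boundary G o ε, edgeIntegral β F (ζ.vertex (n + 1)) ∂boundaryMeasure G o K ε := by
  rw [lintegral_treeMeasure_eq_tsum hG.connected β hF, tsum_ne_root hG.connected]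
  refine tsum_congr fun n => ?_
  rw [hG.lintegral_comp_vertex hK, ENNReal.tsum_mul_left, ← mul_assoc,
    natCast_pow_mul_inv_pow (by omega), one_mul]

theorem lineIntegral_le_edgeIntegral (hT : G.IsTree) (ε : ℝ) {g : Point G o → ℝ≥0∞}
    (hg : Measurable g) (hx : x.vert ≠ o) :
    lineIntegral ε g (vertexPoint G o (parent G o x.vert)) x ≤ edgeIntegral ε g x.vert := by
  rw [lineIntegral, ← setLIntegral_edge_mul_exp hT.connected hx ε hg]
  refine (lintegral_mono_set (geodesic_vertexPoint_parent_subset hT hx)).trans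
    ((lintegral_union_le _ _ _).trans ?_)
  rw [setLIntegral_measure_zero _ _ (lengthMeasure_height_eq hT.connected _), zero_add]

theorem IsUpperGradient.edist_le (hT : G.IsTree) {ε : ℝ} {f : Point G o → ℝ}
    {g : Point G o → ℝ≥0∞} (hg : IsUpperGradient ε f g) (hx : x.vert ≠ o) :
    edist (f (vertexPoint G o (parent G o x.vert))) (f x) ≤ edgeIntegral ε g x.vert := by
  rw [← ofReal_abs_sub_eq_edist]
  exact (hg.2 _ x).trans (lineIntegral_le_edgeIntegral hT ε hg.1 hx)

end Integration

/-! ### A discrete form of the Besov seminorm -/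

section Besov

variable {V : Type*} {G : SimpleGraph V} {o : V} {K n : ℕ} {ε t : ℝ}

/-- The radii `t` for which the balls `B(ζ, t)` are the cylinders of level `n`. -/
def scaleShell (ε : ℝ) (n : ℕ) : Set ℝ := disjointed (fun n => Ioi (visualRadius ε n)) n

theorem scaleShell_zero : scaleShell ε 0 = Ioi (visualRadius ε 0) := disjointed_zero _

theorem scaleShell_succ (hε : 0 < ε) (n : ℕ) :
    scaleShell ε (n + 1) = Ioc (visualRadius ε (n + 1)) (visualRadius ε n) := by
  have hmono : Monotone fun n => Ioi (visualRadius ε n) := fun _ _ h =>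
    Ioi_subset_Ioi ((visualRadius_strictAnti hε).antitone h)
  rw [scaleShell, hmono.disjointed_add_one, Ioi_sdiff_Ioi]

theorem scaleShell_subset_Ioi : scaleShell ε n ⊆ Ioi (visualRadius ε n) := disjointed_subset _ n

theorem measurableSet_scaleShell (n : ℕ) : MeasurableSet (scaleShell ε n) :=
  MeasurableSet.disjointed (fun _ => measurableSet_Ioi) n

theorem iUnion_scaleShell (hε : 0 < ε) : ⋃ n, scaleShell ε n = Ioi 0 := by
  refine iUnion_disjointed.trans (Subset.antisymm ?_ fun t ht => ?_)
  · exact iUnion_subset fun n => Ioi_subset_Ioi (visualRadius_pos hε n).le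
  · exact mem_iUnion.2 ((tendsto_visualRadius hε).eventually (gt_mem_nhds ht)).exists

theorem visualRadius_rpow_neg (hε : 0 < ε) (a : ℝ) (n : ℕ) :
    visualRadius ε n ^ (-a) = (2 / ε) ^ (-a) * Real.exp (a * ε * n) := by
  rw [visualRadius, Real.mul_rpow (by positivity) (by positivity), ← Real.exp_mul]
  ring_nf

theorem lintegral_scaleShell_rpow_le (hε : 0 < ε) {a : ℝ} (ha : 0 < a) (n : ℕ) :
    ∫⁻ t in scaleShell ε n, ENNReal.ofReal (t ^ (-a - 1)) ≤
      ENNReal.ofReal ((2 / ε) ^ (-a) / a) * ENNReal.ofReal (Real.exp (a * ε * n)) := by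
  refine (lintegral_mono_set scaleShell_subset_Ioi).trans_eq ?_
  rw [lintegral_Ioi_rpow ha (visualRadius_pos hε n), visualRadius_rpow_neg hε,
    ← ENNReal.ofReal_mul (by positivity), div_mul_eq_mul_div]

theorem le_lintegral_scaleShell_rpow (hε : 0 < ε) {a : ℝ} (ha : 0 < a) (n : ℕ) :
    ENNReal.ofReal ((2 / ε) ^ (-a) / a * (1 - Real.exp (-(a * ε)))) *
        ENNReal.ofReal (Real.exp (a * ε * n)) ≤
      ∫⁻ t in scaleShell ε n, ENNReal.ofReal (t ^ (-a - 1)) := by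
  have hle : Real.exp (-(a * ε)) ≤ 1 := Real.exp_le_one_iff.2 (neg_nonpos.2 (by positivity))
  rw [← ENNReal.ofReal_mul (mul_nonneg (by positivity) (sub_nonneg.2 hle))]
  cases n with
  | zero =>
    rw [scaleShell_zero, lintegral_Ioi_rpow ha (visualRadius_pos hε 0), visualRadius_rpow_neg hε]
    refine ENNReal.ofReal_le_ofReal ?_
    rw [Nat.cast_zero, mul_zero, Real.exp_zero, mul_one, mul_one]
    exact mul_le_of_le_one_right (by positivity) (sub_le_self _ (Real.exp_pos _).le)
  | succ n =>
    rw [scaleShell_succ hε, lintegral_Ioc_rpow ha (visualRadius_pos hε _)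
      (visualRadius_strictAnti hε n.lt_succ_self).le, visualRadius_rpow_neg hε,
      visualRadius_rpow_neg hε]
    refine (congrArg ENNReal.ofReal ?_).le
    have hexp : Real.exp (a * ε * n) = Real.exp (-(a * ε)) * Real.exp (a * ε * (n + 1 : ℕ)) := by
      rw [← Real.exp_add, Nat.cast_succ]
      ring_nf
    rw [hexp]
    ring

variable [hε : Fact (0 < ε)]

theorem ball_eq_cylinder_of_mem_scaleShell (hT : G.IsTree) (ζ : Boundary G o ε)
    (ht : t ∈ scaleShell ε n) : Metric.ball ζ t = cylinder ε (ζ.vertex n) := by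
  cases n with
  | zero =>
    rw [scaleShell_zero] at ht
    rw [ball_eq_univ hT ζ ht, ζ.vertex_zero, cylinder_root]
  | succ n => exact ball_eq_cylinder hT ζ (scaleShell_succ hε.out n ▸ ht)

/-- The mean oscillation of `u` over the cylinders of level `n`. -/
def cylinderOsc (K : ℕ) (p : ℝ) (u : Boundary G o ε → ℝ) (n : ℕ) : ℝ≥0∞ :=
  ∫⁻ ζ, (⨍⁻ ξ in cylinder ε (ζ.vertex n), ENNReal.ofReal |u ζ - u ξ| ^ p ∂boundaryMeasure G o K ε)
    ∂boundaryMeasure G o K ε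

/-- The discrete counterpart of the `p`-th power of the Besov seminorm: the integral over the scales
`t` is replaced by a sum over the levels `n` of the tree. -/
def discreteBesovEnergy (K : ℕ) (θ p : ℝ) (u : Boundary G o ε → ℝ) : ℝ≥0∞ :=
  ∑' n : ℕ, ENNReal.ofReal (Real.exp (θ * p * ε * n)) * cylinderOsc K p u n

theorem besovE_rpow_div (hT : G.IsTree) {θ p : ℝ} (hp : 0 < p) (u : Boundary G o ε → ℝ)
    (ht : t ∈ scaleShell ε n) :
    (besovE K p u t / ENNReal.ofReal (t ^ θ)) ^ p / ENNReal.ofReal t =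
      cylinderOsc K p u n * ENNReal.ofReal (t ^ (-(θ * p) - 1)) := by
  have ht0 : 0 < t := (visualRadius_pos hε.out n).trans (scaleShell_subset_Ioi ht)
  have htθ : 0 < t ^ θ := Real.rpow_pos_of_pos ht0 θ
  have hE : besovE K p u t ^ p = cylinderOsc K p u n := by
    rw [besovE, cylinderOsc, one_div, ENNReal.rpow_inv_rpow hp.ne']
    simp_rw [ball_eq_cylinder_of_mem_scaleShell hT _ ht]
  rw [ENNReal.div_rpow_of_nonneg _ _ hp.le, hE, ENNReal.ofReal_rpow_of_pos htθ,
    ← Real.rpow_mul ht0.le, div_eq_mul_inv, div_eq_mul_inv, mul_assoc,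
    ← ENNReal.ofReal_inv_of_pos ht0, ← ENNReal.ofReal_inv_of_pos (by positivity),
    ← ENNReal.ofReal_mul (by positivity), Real.rpow_sub_one ht0.ne', Real.rpow_neg ht0.le,
    div_eq_mul_inv]

theorem besovSeminorm_rpow (hT : G.IsTree) (θ : ℝ) {p : ℝ} (hp : 0 < p) (u : Boundary G o ε → ℝ) :
    besovSeminorm K θ p p u ^ p = ∑' n : ℕ, cylinderOsc K p u n *
      ∫⁻ t in scaleShell ε n, ENNReal.ofReal (t ^ (-(θ * p) - 1)) := by
  rw [besovSeminorm, one_div, ENNReal.rpow_inv_rpow hp.ne', ← iUnion_scaleShell hε.out,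
    lintegral_iUnion measurableSet_scaleShell (disjoint_disjointed _)]
  refine tsum_congr fun n => ?_
  rw [setLIntegral_congr_fun (measurableSet_scaleShell n) fun t ht => besovE_rpow_div hT hp u ht,
    lintegral_const_mul _ (by fun_prop)]

theorem besovSeminorm_rpow_le (hT : G.IsTree) {θ p : ℝ} (hp : 0 < p) (hθ : 0 < θ)
    (u : Boundary G o ε → ℝ) :
    besovSeminorm K θ p p u ^ p ≤
      ENNReal.ofReal ((2 / ε) ^ (-(θ * p)) / (θ * p)) * discreteBesovEnergy K θ p u := by
  rw [besovSeminorm_rpow hT θ hp, discreteBesovEnergy, ← ENNReal.tsum_mul_left]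
  refine ENNReal.tsum_le_tsum fun n => ?_
  rw [← mul_assoc, mul_comm _ (cylinderOsc K p u n)]
  gcongr
  exact lintegral_scaleShell_rpow_le hε.out (by positivity) n

theorem discreteBesovEnergy_le (hT : G.IsTree) {θ p : ℝ} (hp : 0 < p) (hθ : 0 < θ)
    (u : Boundary G o ε → ℝ) :
    ENNReal.ofReal ((2 / ε) ^ (-(θ * p)) / (θ * p) * (1 - Real.exp (-(θ * p * ε)))) *
      discreteBesovEnergy K θ p u ≤ besovSeminorm K θ p p u ^ p := by
  rw [besovSeminorm_rpow hT θ hp, discreteBesovEnergy, ← ENNReal.tsum_mul_left]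
  refine ENNReal.tsum_le_tsum fun n => ?_
  rw [← mul_assoc, mul_comm _ (cylinderOsc K p u n)]
  gcongr
  exact le_lintegral_scaleShell_rpow hε.out (by positivity) n

end Besov

/-! ### Traces of Newtonian functions -/

section Trace

variable {V : Type*} {G : SimpleGraph V} {o : V} {ε : ℝ} {f : Point G o → ℝ} {g : Point G o → ℝ≥0∞}

theorem isProbabilityMeasure_restrict_edgeHeights (v : V) :
    IsProbabilityMeasure (volume.restrict (edgeHeights G o v)) := ⟨by simp⟩

theorem edgeIntegral_rpow_le (hε : 0 < ε) {β p : ℝ} (hβ : 0 ≤ β) (hp : 1 ≤ p) {v : V} {n : ℕ}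
    (hv : G.dist o v = n + 1) (hg : Measurable g) :
    edgeIntegral ε g v ^ p ≤ ENNReal.ofReal (Real.exp (β * (n + 1) - ε * p * n)) *
      edgeIntegral β (fun z => g z ^ p) v := by
  have hm := measurable_edgePoint (G := G) (o := o) v
  have := isProbabilityMeasure_restrict_edgeHeights (G := G) (o := o) v
  refine (lintegral_rpow_le_of_isProbabilityMeasure hp (by fun_prop)).trans ?_
  rw [edgeIntegral, ← lintegral_const_mul _ (by fun_prop)]
  refine setLIntegral_mono (by fun_prop) fun t ht => ?_
  rw [edgeHeights, hv, Nat.cast_add_one, add_sub_cancel_right] at ht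
  rw [ENNReal.mul_rpow_of_nonneg _ _ (by linarith), mul_left_comm,
    ENNReal.ofReal_rpow_of_pos (Real.exp_pos _), ← ENNReal.ofReal_mul (Real.exp_pos _).le,
    ← Real.exp_mul, ← Real.exp_add]
  gcongr
  have hβt : β * t ≤ β * (n + 1) := mul_le_mul_of_nonneg_left ht.2 hβ
  have hεn : ε * p * n ≤ ε * p * t := mul_le_mul_of_nonneg_left ht.1.le (by positivity)
  linarith

theorem edgeIntegral_le_lintegral_treeMeasure (hG : G.Connected) (β : ℝ) {v : V} (hv : v ≠ o)
    {F : Point G o → ℝ≥0∞} (hF : Measurable F) :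
    edgeIntegral β F v ≤ ∫⁻ z, F z ∂treeMeasure G o β := by
  rw [lintegral_treeMeasure_eq_tsum hG β hF]
  exact ENNReal.le_tsum (f := fun v : {v : V // v ≠ o} => edgeIntegral β F v) ⟨v, hv⟩

theorem le_mul_lintegral_treeMeasure_of_le_on_edge (hG : G.Connected) {β : ℝ} (hβ : 0 ≤ β) {v : V}
    (hv : G.dist o v = 1) {F : Point G o → ℝ≥0∞} {a : ℝ≥0∞} (h : ∀ z, z.vert = v → a ≤ F z) :
    a ≤ ENNReal.ofReal (Real.exp β) * ∫⁻ z, F z ∂treeMeasure G o β := by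
  have hv0 : v ≠ o := ne_root_of_dist hv
  have hS : MeasurableSet {z : Point G o | z.vert = v} := Point.measurableSet_vert {v}
  have hm := measurable_edgePoint (G := G) (o := o) v
  have hind : Measurable ({z : Point G o | z.vert = v}.indicator fun _ => a) :=
    measurable_const.indicator hS
  have := isProbabilityMeasure_restrict_edgeHeights (G := G) (o := o) v
  calc a = ∫⁻ _ in edgeHeights G o v, a := by rw [lintegral_const, measure_univ, mul_one]
    _ ≤ ENNReal.ofReal (Real.exp β) *
          edgeIntegral β ({z : Point G o | z.vert = v}.indicator fun _ => a) v := by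
        rw [edgeIntegral, ← lintegral_const_mul _ (by fun_prop)]
        refine setLIntegral_mono (by fun_prop) fun t ht => ?_
        have hmem : edgePoint G o v t ∈ {z : Point G o | z.vert = v} := (edgePoint_spec hG hv0 ht).1
        rw [indicator_of_mem hmem, mul_left_comm, ← ENNReal.ofReal_mul (Real.exp_pos _).le,
          ← Real.exp_add]
        rw [edgeHeights, hv, Nat.cast_one] at ht
        refine le_mul_of_one_le_right' ?_
        rw [ENNReal.one_le_ofReal, Real.one_le_exp_iff]
        nlinarith [ht.2]
    _ ≤ ENNReal.ofReal (Real.exp β) * ∫⁻ z, F z ∂treeMeasure G o β := by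
        gcongr
        refine (edgeIntegral_le_lintegral_treeMeasure hG β hv0 hind).trans
          (lintegral_mono fun z => ?_)
        by_cases hz : z.vert = v
        · simpa [indicator, hz] using h z hz
        · simp [indicator, hz]

/-- The integral of `g` along the part of the ray `ζ` that lies below the level `n`, as a sum of
edge integrals. -/
def rayTail (g : Point G o → ℝ≥0∞) (n : ℕ) (ζ : Boundary G o ε) : ℝ≥0∞ :=
  ∑' j, edgeIntegral ε g (ζ.vertex (n + j + 1))

theorem edist_vertexPoint_ray_le (hT : G.IsTree) (hg : IsUpperGradient ε f g)
    (ζ : Boundary G o ε) {n : ℕ} {t : ℝ≥0} (h : ⌈(t : ℝ)⌉₊ = n + 1) :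
    edist (f (vertexPoint G o (ζ.vertex n))) (f (ζ.ray t)) ≤
      edgeIntegral ε g (ζ.vertex (n + 1)) := by
  have hv : (ζ.ray t).vert = ζ.vertex (n + 1) := by simp [Boundary.ray, h]
  have hle := hg.edist_le (x := ζ.ray t) hT (hv ▸ ζ.vertex_succ_ne_root n)
  rwa [hv, ζ.parent_vertex hT] at hle

theorem Boundary.ray_natCast (ζ : Boundary G o ε) (n : ℕ) :
    ζ.ray n = vertexPoint G o (ζ.vertex n) := by
  ext <;> simp [Boundary.ray, vertexPoint, ζ.dist_vertex]

theorem edist_vertexPoint_succ_le (hT : G.IsTree) (hg : IsUpperGradient ε f g)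
    (ζ : Boundary G o ε) (n : ℕ) :
    edist (f (vertexPoint G o (ζ.vertex n))) (f (vertexPoint G o (ζ.vertex (n + 1)))) ≤
      edgeIntegral ε g (ζ.vertex (n + 1)) := by
  rw [← ζ.ray_natCast (n + 1)]
  exact edist_vertexPoint_ray_le hT hg ζ (by rw [NNReal.coe_natCast, Nat.ceil_natCast])

theorem tendsto_vertexPoint_of_tendsto_ray {ζ : Boundary G o ε} {l : ℝ}
    (h : Tendsto (fun t : ℝ≥0 => f (ζ.ray t)) atTop (𝓝 l)) :
    Tendsto (fun n : ℕ => f (vertexPoint G o (ζ.vertex n))) atTop (𝓝 l) := by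
  simpa only [Function.comp_def, ζ.ray_natCast] using h.comp tendsto_natCast_atTop_atTop

theorem edist_vertexPoint_le_rayTail (hT : G.IsTree) (hg : IsUpperGradient ε f g)
    {ζ : Boundary G o ε} {l : ℝ} (h : Tendsto (fun t : ℝ≥0 => f (ζ.ray t)) atTop (𝓝 l)) (n : ℕ) :
    edist (f (vertexPoint G o (ζ.vertex n))) l ≤ rayTail g n ζ :=
  edist_le_tsum_of_edist_le_of_tendsto (fun n => edgeIntegral ε g (ζ.vertex (n + 1)))
    (fun n => edist_vertexPoint_succ_le hT hg ζ n) (tendsto_vertexPoint_of_tendsto_ray h) n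

theorem tendsto_nat_ceil_sub_one : Tendsto (fun t : ℝ≥0 => ⌈(t : ℝ)⌉₊ - 1) atTop atTop :=
  (tendsto_sub_atTop_nat 1).comp
    (tendsto_nat_ceil_atTop.comp (NNReal.tendsto_coe_atTop.2 tendsto_id))

theorem tendsto_ray_of_tendsto_vertexPoint {ζ : Boundary G o ε} {l : ℝ} {d : ℕ → ℝ≥0∞}
    (hd : Tendsto d atTop (𝓝 0))
    (hfd : ∀ (n : ℕ) (t : ℝ≥0), ⌈(t : ℝ)⌉₊ = n + 1 →
      edist (f (vertexPoint G o (ζ.vertex n))) (f (ζ.ray t)) ≤ d n)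
    (h : Tendsto (fun n : ℕ => f (vertexPoint G o (ζ.vertex n))) atTop (𝓝 l)) :
    Tendsto (fun t : ℝ≥0 => f (ζ.ray t)) atTop (𝓝 l) := by
  rw [tendsto_iff_edist_tendsto_0] at h ⊢
  have hlim := (hd.add h).comp tendsto_nat_ceil_sub_one
  rw [add_zero] at hlim
  refine tendsto_of_tendsto_of_tendsto_of_le_of_le' tendsto_const_nhds hlim
    (Eventually.of_forall fun _ => zero_le) ?_
  filter_upwards [eventually_gt_atTop 0] with t ht
  have hceil : ⌈(t : ℝ)⌉₊ = ⌈(t : ℝ)⌉₊ - 1 + 1 := by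
    have : 0 < ⌈(t : ℝ)⌉₊ := Nat.ceil_pos.2 ht
    omega
  refine (edist_triangle _ _ _).trans (add_le_add ?_ le_rfl)
  rw [edist_comm]
  exact hfd _ t hceil

theorem exists_tendsto_ray (hT : G.IsTree) (hg : IsUpperGradient ε f g) {ζ : Boundary G o ε}
    (hζ : rayTail g 0 ζ ≠ ∞) : ∃ l, Tendsto (fun t : ℝ≥0 => f (ζ.ray t)) atTop (𝓝 l) := by
  have hsum : ∑' n, edgeIntegral ε g (ζ.vertex (n + 1)) ≠ ∞ := by simpa [rayTail] using hζ
  obtain ⟨l, hl⟩ := cauchySeq_tendsto_of_complete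
    (cauchySeq_of_edist_le_of_tsum_ne_top _ (edist_vertexPoint_succ_le hT hg ζ) hsum)
  exact ⟨l, tendsto_ray_of_tendsto_vertexPoint (ENNReal.tendsto_atTop_zero_of_tsum_ne_top hsum)
    (fun n t h => edist_vertexPoint_ray_le hT hg ζ h) hl⟩

variable {K : ℕ} [hε : Fact (0 < ε)] {u : Boundary G o ε → ℝ}

theorem measurable_rayTail [Countable V] (hT : G.IsTree) (g : Point G o → ℝ≥0∞) (n : ℕ) :
    Measurable (rayTail g n : Boundary G o ε → ℝ≥0∞) :=
  Measurable.tsum fun j => measurable_comp_vertex hT (edgeIntegral ε g) (n + j + 1)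

theorem IsTrace.aemeasurable [Countable V] (hT : G.IsTree) (h : IsTrace K f u) :
    AEMeasurable u (boundaryMeasure G o K ε) :=
  aemeasurable_of_tendsto_metrizable_ae atTop
    (fun n => (measurable_comp_vertex hT (fun v => f (vertexPoint G o v)) n).aemeasurable)
    (h.mono fun _ hζ => tendsto_vertexPoint_of_tendsto_ray hζ)

theorem IsKaryTree.cylinderOsc_le (hK : 2 ≤ K) (hG : IsKaryTree G o K) {p : ℝ} (hp : 1 ≤ p)
    (n : ℕ) (c : V → ℝ) {T : Boundary G o ε → ℝ≥0∞} (hTm : Measurable T)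
    (h : ∀ᵐ ζ ∂boundaryMeasure G o K ε, edist (c (ζ.vertex n)) (u ζ) ≤ T ζ) :
    cylinderOsc K p u n ≤ 2 ^ p * ∫⁻ ζ, T ζ ^ p ∂boundaryMeasure G o K ε := by
  have := hG.countable
  have := hG.isProbabilityMeasure_boundaryMeasure (ε := ε) hK
  have hosc : ∀ᵐ ζ ∂boundaryMeasure G o K ε,
      (⨍⁻ ξ in cylinder ε (ζ.vertex n), ENNReal.ofReal |u ζ - u ξ| ^ p ∂boundaryMeasure G o K ε) ≤
      2 ^ (p - 1) * (T ζ ^ p +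
        ⨍⁻ ξ in cylinder ε (ζ.vertex n), T ξ ^ p ∂boundaryMeasure G o K ε) := by
    filter_upwards [h] with ζ hζ
    have := hG.neZero_restrict_cylinder (ε := ε) hK (ζ.vertex n)
    refine laverage_abs_sub_rpow_le hp hζ ?_
    filter_upwards [ae_restrict_of_ae h, ae_restrict_mem (measurableSet_cylinder hG.isTree _)]
      with ξ hξ hmem
    rwa [mem_cylinder_vertex_iff.1 hmem] at hξ
  refine (lintegral_mono_ae hosc).trans_eq ?_
  rw [lintegral_const_mul' _ _ (ENNReal.rpow_ne_top_of_nonneg (by linarith) (by simp)),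
    lintegral_add_left (by fun_prop), hG.lintegral_laverage_cylinder hK, ← two_mul, ← mul_assoc,
    rpow_sub_one_mul_self hp]

variable {β p θ : ℝ}

theorem IsKaryTree.tsum_lintegral_edgeIntegral_rpow_le (hK : 2 ≤ K) (hG : IsKaryTree G o K)
    (hβ : 0 ≤ β) (hp : 1 ≤ p) (hθ : θ * p * ε = p * ε - (β - Real.log K)) (hg : Measurable g) :
    ∑' n : ℕ, ENNReal.ofReal (Real.exp (θ * p * ε * n)) *
      ∫⁻ ζ : Boundary G o ε, edgeIntegral ε g (ζ.vertex (n + 1)) ^ p ∂boundaryMeasure G o K ε ≤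
    ENNReal.ofReal (Real.exp β) * ∫⁻ z, g z ^ p ∂treeMeasure G o β := by
  have hK0 : K ≠ 0 := by omega
  rw [hG.lintegral_treeMeasure (ε := ε) hK β (hg.pow_const p), ← ENNReal.tsum_mul_left]
  refine ENNReal.tsum_le_tsum fun n => ?_
  calc ENNReal.ofReal (Real.exp (θ * p * ε * n)) *
        ∫⁻ ζ : Boundary G o ε, edgeIntegral ε g (ζ.vertex (n + 1)) ^ p ∂boundaryMeasure G o K ε
      ≤ ENNReal.ofReal (Real.exp (θ * p * ε * n)) * ∫⁻ ζ : Boundary G o ε,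
          ENNReal.ofReal (Real.exp (β * (n + 1) - ε * p * n)) *
            edgeIntegral β (fun z => g z ^ p) (ζ.vertex (n + 1)) ∂boundaryMeasure G o K ε := by
        gcongr with ζ
        exact edgeIntegral_rpow_le hε.out hβ hp (ζ.dist_vertex (n + 1)) hg
    _ = ENNReal.ofReal (Real.exp β) * ((K : ℝ≥0∞) ^ n * ∫⁻ ζ : Boundary G o ε,
          edgeIntegral β (fun z => g z ^ p) (ζ.vertex (n + 1)) ∂boundaryMeasure G o K ε) := by
        rw [lintegral_const_mul' _ _ ENNReal.ofReal_ne_top, ← mul_assoc, ← mul_assoc,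
          ← ofReal_exp_natCast_mul_log hK0, ← ENNReal.ofReal_mul (Real.exp_pos _).le,
          ← ENNReal.ofReal_mul (Real.exp_pos _).le, ← Real.exp_add, ← Real.exp_add, hθ]
        congr 3
        ring
    _ ≤ ENNReal.ofReal (Real.exp β) * ((K : ℝ≥0∞) ^ (n + 1) * ∫⁻ ζ : Boundary G o ε,
          edgeIntegral β (fun z => g z ^ p) (ζ.vertex (n + 1)) ∂boundaryMeasure G o K ε) := by
        gcongr
        · exact_mod_cast Nat.one_le_iff_ne_zero.2 hK0
        · omega

theorem IsKaryTree.exists_tsum_lintegral_rayTail_rpow_le (hK : 2 ≤ K) (hG : IsKaryTree G o K)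
    (hβ : 0 ≤ β) (hp : 1 ≤ p) (hθ : θ * p * ε = p * ε - (β - Real.log K)) (hθ0 : 0 < θ) :
    ∃ C : ℝ≥0, ∀ g : Point G o → ℝ≥0∞, Measurable g →
      ∑' n : ℕ, ENNReal.ofReal (Real.exp (θ * p * ε * n)) *
        ∫⁻ ζ : Boundary G o ε, rayTail g n ζ ^ p ∂boundaryMeasure G o K ε ≤
      C * ∫⁻ z, g z ^ p ∂treeMeasure G o β := by
  have := hG.countable
  have hpow (n : ℕ) : ENNReal.ofReal (Real.exp (θ * p * ε * n)) =
      ((ENNReal.ofReal (Real.exp (-(θ * ε))))⁻¹ ^ p) ^ n := by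
    rw [inv_ofReal_exp_neg_rpow_pow, mul_right_comm θ ε p]
  have hfin := ENNReal.rpow_ne_top_of_nonneg (y := p) (by linarith)
    (tsum_ofReal_exp_neg_pow_ne_top (mul_pos hθ0 hε.out))
  refine ⟨((∑' j : ℕ, ENNReal.ofReal (Real.exp (-(θ * ε))) ^ j) ^ p *
    ENNReal.ofReal (Real.exp β)).toNNReal, fun g hg => ?_⟩
  rw [ENNReal.coe_toNNReal (ENNReal.mul_ne_top hfin ENNReal.ofReal_ne_top),
    mul_assoc (_ ^ p)]
  refine le_trans ?_ (mul_le_mul_right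
    (hG.tsum_lintegral_edgeIntegral_rpow_le (ε := ε) hK hβ hp hθ hg) _)
  simp_rw [hpow]
  exact tsum_mul_lintegral_tsum_add_rpow_le _ hp (by simp [Real.exp_pos]) ENNReal.ofReal_ne_top
    fun n => measurable_comp_vertex hG.isTree (edgeIntegral ε g) (n + 1)

theorem IsKaryTree.exists_lintegral_rayTail_zero_rpow_le (hK : 2 ≤ K) (hG : IsKaryTree G o K)
    (hβ : 0 ≤ β) (hp : 1 ≤ p) (hθ : θ * p * ε = p * ε - (β - Real.log K)) (hθ0 : 0 < θ) :
    ∃ C : ℝ≥0, ∀ g : Point G o → ℝ≥0∞, Measurable g →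
      ∫⁻ ζ : Boundary G o ε, rayTail g 0 ζ ^ p ∂boundaryMeasure G o K ε ≤
        C * ∫⁻ z, g z ^ p ∂treeMeasure G o β := by
  obtain ⟨C, hC⟩ := hG.exists_tsum_lintegral_rayTail_rpow_le (ε := ε) hK hβ hp hθ hθ0
  refine ⟨C, fun g hg => ?_⟩
  simpa using (ENNReal.le_tsum 0).trans (hC g hg)

theorem IsKaryTree.exists_isTrace (hK : 2 ≤ K) (hG : IsKaryTree G o K)
    (hβ : 0 ≤ β) (hp : 1 ≤ p) (hθ : θ * p * ε = p * ε - (β - Real.log K)) (hθ0 : 0 < θ)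
    (hg : IsUpperGradient ε f g) (hgp : ∫⁻ z, g z ^ p ∂treeMeasure G o β ≠ ∞) :
    ∃ u : Boundary G o ε → ℝ, IsTrace K f u := by
  have := hG.countable
  have := hG.isProbabilityMeasure_boundaryMeasure (ε := ε) hK
  obtain ⟨C, hC⟩ := hG.exists_lintegral_rayTail_zero_rpow_le (ε := ε) hK hβ hp hθ hθ0
  have hfin := ne_top_of_le_ne_top (ENNReal.mul_ne_top ENNReal.coe_ne_top hgp) (hC g hg.1)
  have htail := ae_lt_top ((measurable_rayTail hG.isTree g 0).pow_const p) hfin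
  have hlim : ∀ᵐ ζ ∂boundaryMeasure G o K ε,
      ∃ l, Tendsto (fun t : ℝ≥0 => f (ζ.ray t)) atTop (𝓝 l) := by
    filter_upwards [htail] with ζ hζ
    exact exists_tendsto_ray hG.isTree hg fun htop => by
      simp [htop, ENNReal.top_rpow_of_pos (show 0 < p by linarith)] at hζ
  exact hlim.choice

theorem IsKaryTree.exists_discreteBesovEnergy_trace_le (hK : 2 ≤ K) (hG : IsKaryTree G o K)
    (hβ : 0 ≤ β) (hp : 1 ≤ p) (hθ : θ * p * ε = p * ε - (β - Real.log K)) (hθ0 : 0 < θ) :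
    ∃ C : ℝ≥0, ∀ (f : Point G o → ℝ) (g : Point G o → ℝ≥0∞) (u : Boundary G o ε → ℝ),
      IsUpperGradient ε f g → IsTrace K f u →
      discreteBesovEnergy K θ p u ≤ C * ∫⁻ z, g z ^ p ∂treeMeasure G o β := by
  have := hG.countable
  obtain ⟨C, hC⟩ := hG.exists_tsum_lintegral_rayTail_rpow_le (ε := ε) hK hβ hp hθ hθ0
  refine ⟨2 ^ p * C, fun f g u hg hu => ?_⟩
  have hosc (n : ℕ) : cylinderOsc K p u n ≤
      2 ^ p * ∫⁻ ζ : Boundary G o ε, rayTail g n ζ ^ p ∂boundaryMeasure G o K ε :=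
    hG.cylinderOsc_le hK hp n (fun v => f (vertexPoint G o v)) (measurable_rayTail hG.isTree g n)
      (hu.mono fun _ hζ => edist_vertexPoint_le_rayTail hG.isTree hg hζ n)
  calc discreteBesovEnergy K θ p u
      ≤ ∑' n : ℕ, 2 ^ p * (ENNReal.ofReal (Real.exp (θ * p * ε * n)) *
          ∫⁻ ζ : Boundary G o ε, rayTail g n ζ ^ p ∂boundaryMeasure G o K ε) :=
        ENNReal.tsum_le_tsum fun n => by
          rw [mul_left_comm]
          gcongr
          exact hosc n
    _ ≤ 2 ^ p * (C * ∫⁻ z, g z ^ p ∂treeMeasure G o β) := by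
        rw [ENNReal.tsum_mul_left]
        gcongr
        exact hC g hg.1
    _ = _ := by
        rw [← mul_assoc, ENNReal.coe_mul, ENNReal.coe_rpow_of_nonneg _ (by linarith),
          ENNReal.coe_ofNat]

/-- The `p`-th power of the Newtonian norm of `f`, computed with the upper gradient `g`. -/
def newtonEnergy (β p : ℝ) (f : Point G o → ℝ) (g : Point G o → ℝ≥0∞) : ℝ≥0∞ :=
  (∫⁻ x, ENNReal.ofReal |f x| ^ p ∂treeMeasure G o β) + ∫⁻ x, g x ^ p ∂treeMeasure G o β

theorem IsKaryTree.enorm_root_rpow_le (hK : K ≠ 0) (hG : IsKaryTree G o K) (hβ : 0 ≤ β)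
    (hp : 1 ≤ p) (hg : IsUpperGradient ε f g) :
    ‖f (vertexPoint G o o)‖ₑ ^ p ≤
      2 ^ (p - 1) * (ENNReal.ofReal (Real.exp β) * newtonEnergy β p f g) := by
  obtain ⟨v, hv, hpar⟩ := hG.children_nonempty hK o
  have hd : G.dist o v = 0 + 1 := by
    rw [(parent_spec hG.connected hv).2, hpar, SimpleGraph.dist_self]
  have hedge : edgeIntegral ε g v ^ p ≤
      ENNReal.ofReal (Real.exp β) * ∫⁻ z, g z ^ p ∂treeMeasure G o β := by
    refine (edgeIntegral_rpow_le hε.out hβ hp hd hg.1).trans ?_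
    simpa using mul_le_mul_right
      (edgeIntegral_le_lintegral_treeMeasure hG.connected β hv (hg.1.pow_const p)) _
  have hvalue : (‖f (vertexPoint G o o)‖ₑ - edgeIntegral ε g v) ^ p ≤
      ENNReal.ofReal (Real.exp β) * ∫⁻ z, ENNReal.ofReal |f z| ^ p ∂treeMeasure G o β := by
    refine le_mul_lintegral_treeMeasure_of_le_on_edge hG.connected hβ hd fun z hz => ?_
    refine ENNReal.rpow_le_rpow (tsub_le_iff_right.2 ?_) (by linarith)
    have hdist := hg.edist_le (x := z) hG.isTree (hz ▸ hv)
    rw [hz, hpar] at hdist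
    have htri := edist_triangle (f (vertexPoint G o o)) (f z) 0
    rw [edist_zero_right, edist_zero_right, add_comm, Real.enorm_eq_ofReal_abs (f z)] at htri
    exact htri.trans (by gcongr)
  calc ‖f (vertexPoint G o o)‖ₑ ^ p
      ≤ (‖f (vertexPoint G o o)‖ₑ - edgeIntegral ε g v + edgeIntegral ε g v) ^ p :=
        ENNReal.rpow_le_rpow le_tsub_add (by linarith)
    _ ≤ _ := ENNReal.rpow_add_le_mul_rpow_add_rpow _ _ hp
    _ ≤ _ := by
        rw [newtonEnergy, mul_add (ENNReal.ofReal _)]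
        gcongr

theorem IsKaryTree.exists_lintegral_trace_rpow_le (hK : 2 ≤ K) (hG : IsKaryTree G o K)
    (hβ : 0 ≤ β) (hp : 1 ≤ p) (hθ : θ * p * ε = p * ε - (β - Real.log K)) (hθ0 : 0 < θ) :
    ∃ C : ℝ≥0, ∀ (f : Point G o → ℝ) (g : Point G o → ℝ≥0∞) (u : Boundary G o ε → ℝ),
      IsUpperGradient ε f g → IsTrace K f u →
      ∫⁻ ζ, ‖u ζ‖ₑ ^ p ∂boundaryMeasure G o K ε ≤ C * newtonEnergy β p f g := by
  have := hG.isProbabilityMeasure_boundaryMeasure (ε := ε) hK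
  have hpow : (2 : ℝ≥0∞) ^ (p - 1) ≠ ∞ := ENNReal.rpow_ne_top_of_nonneg (by linarith) (by simp)
  obtain ⟨C, hC⟩ := hG.exists_lintegral_rayTail_zero_rpow_le (ε := ε) hK hβ hp hθ hθ0
  refine ⟨(2 ^ (p - 1) * (2 ^ (p - 1) * ENNReal.ofReal (Real.exp β) + C) : ℝ≥0∞).toNNReal,
    fun f g u hg hu => ?_⟩
  rw [ENNReal.coe_toNNReal (by finiteness)]
  have hbound : ∀ᵐ ζ ∂boundaryMeasure G o K ε, ‖u ζ‖ₑ ^ p ≤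
      2 ^ (p - 1) * (‖f (vertexPoint G o o)‖ₑ ^ p + rayTail g 0 ζ ^ p) := by
    filter_upwards [hu] with ζ hζ
    have hdist := edist_vertexPoint_le_rayTail hG.isTree hg hζ 0
    rw [ζ.vertex_zero] at hdist
    exact enorm_add_rpow_le hp hdist
  calc ∫⁻ ζ, ‖u ζ‖ₑ ^ p ∂boundaryMeasure G o K ε
      ≤ 2 ^ (p - 1) * (‖f (vertexPoint G o o)‖ₑ ^ p +
          ∫⁻ ζ : Boundary G o ε, rayTail g 0 ζ ^ p ∂boundaryMeasure G o K ε) := by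
        refine (lintegral_mono_ae hbound).trans_eq ?_
        rw [lintegral_const_mul' _ _ hpow, lintegral_add_left measurable_const, lintegral_const,
          measure_univ, mul_one]
    _ ≤ 2 ^ (p - 1) * (2 ^ (p - 1) * (ENNReal.ofReal (Real.exp β) * newtonEnergy β p f g) +
          C * newtonEnergy β p f g) := by
        gcongr
        · exact hG.enorm_root_rpow_le (by omega) hβ hp hg
        · exact (hC g hg.1).trans (mul_le_mul_right le_add_self _)
    _ = _ := by ring

end Trace

/-! ### Extension from the vertices to the metric tree -/

section Extension

variable {V : Type*} {G : SimpleGraph V} {o : V} {ε : ℝ} {x : Point G o}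

/-- The function on the metric tree that agrees with `a` at the vertices and is affine, as a
function of the height, on every edge. -/
def edgeExtension (a : V → ℝ) (x : Point G o) : ℝ :=
  AffineMap.lineMap (a (parent G o x.vert)) (a x.vert) (x.height - (G.dist o x.vert - 1))

/-- The derivative of `edgeExtension a` with respect to the height. -/
def edgeDeriv (a : V → ℝ) (x : Point G o) : ℝ := a x.vert - a (parent G o x.vert)

/-- The modulus of the derivative of `edgeExtension a` with respect to arc length for `d_X`. -/
def edgeSlope (ε : ℝ) (a : V → ℝ) (x : Point G o) : ℝ≥0∞ :=
  edist (a x.vert) (a (parent G o x.vert)) * ENNReal.ofReal (Real.exp (ε * x.height))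

theorem edgeExtension_eq (a : V → ℝ) (x : Point G o) :
    edgeExtension a x =
      a (parent G o x.vert) + (x.height - (G.dist o x.vert - 1)) * edgeDeriv a x := by
  rw [edgeExtension, edgeDeriv, AffineMap.lineMap_apply_ring', add_comm]

theorem edgeExtension_vertexPoint (a : V → ℝ) (v : V) :
    edgeExtension a (vertexPoint G o v) = a v := by
  simp [edgeExtension, vertexPoint]

theorem measurable_edgeExtension (a : V → ℝ) : Measurable (edgeExtension a : Point G o → ℝ) := by
  have hheight := Point.measurable_height (G := G) (o := o)
  have hparent := Point.measurable_comp_vert (G := G) (o := o) fun v => a (parent G o v)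
  have hderiv := Point.measurable_comp_vert (G := G) (o := o) fun v => a v - a (parent G o v)
  have hbase := Point.measurable_comp_vert (G := G) (o := o) fun v => (G.dist o v : ℝ) - 1
  rw [funext (edgeExtension_eq a)]
  exact hparent.add ((hheight.sub hbase).mul hderiv)

theorem measurable_edgeSlope (a : V → ℝ) : Measurable (edgeSlope ε a : Point G o → ℝ≥0∞) := by
  have hheight := Point.measurable_height (G := G) (o := o)
  have hedist := Point.measurable_comp_vert (G := G) (o := o)
    fun v => edist (a v) (a (parent G o v))
  exact hedist.mul (by fun_prop)

theorem enorm_edgeDeriv (ε : ℝ) (a : V → ℝ) (x : Point G o) :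
    ‖edgeDeriv a x‖ₑ = edgeSlope ε a x * ENNReal.ofReal (Real.exp (-ε * x.height)) := by
  rw [edgeSlope, mul_assoc, ← ENNReal.ofReal_mul (Real.exp_pos _).le, ← Real.exp_add, edgeDeriv,
    edist_eq_enorm_sub]
  simp

theorem lengthMeasure_segment_of_vert_eq_root (hG : G.Connected) (hx : x.vert = o) :
    lengthMeasure G o (segment x) = 0 := by
  have hh : x.height ≤ 0 := by simpa [hx] using x.height_le
  exact measure_mono_null (fun z hz => le_antisymm (hz.1.trans hh) z.height_nonneg)
    (lengthMeasure_height_eq hG 0)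

theorem edgeDeriv_eqOn_lastEdge (a : V → ℝ) (x : Point G o) :
    EqOn (edgeDeriv a) (fun _ => edgeDeriv a x) (lastEdge x) := by
  rintro z ⟨hz, -⟩
  simp only [edgeDeriv, hz]

theorem integrableOn_edgeDeriv_lastEdge (hG : G.Connected) (a : V → ℝ) (hx : x.vert ≠ o) :
    IntegrableOn (edgeDeriv a) (lastEdge x) (lengthMeasure G o) := by
  refine IntegrableOn.congr_fun (integrableOn_const ?_) (edgeDeriv_eqOn_lastEdge a x).symm
    (measurableSet_lastEdge x)
  rw [lengthMeasure_lastEdge hG hx]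
  exact ENNReal.ofReal_ne_top

theorem setIntegral_edgeDeriv_lastEdge (hG : G.Connected) (a : V → ℝ) (hx : x.vert ≠ o) :
    ∫ z in lastEdge x, edgeDeriv a z ∂lengthMeasure G o =
      edgeExtension a x - a (parent G o x.vert) := by
  rw [setIntegral_congr_fun (measurableSet_lastEdge x) (edgeDeriv_eqOn_lastEdge a x),
    setIntegral_const, measureReal_def, lengthMeasure_lastEdge hG hx,
    ENNReal.toReal_ofReal (by linarith [x.lt_height]), edgeExtension_eq, smul_eq_mul,
    add_sub_cancel_left]

theorem integrableOn_edgeDeriv_segment (hT : G.IsTree) (a : V → ℝ) (x : Point G o) :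
    IntegrableOn (edgeDeriv a) (segment x) (lengthMeasure G o) := by
  induction hn : G.dist o x.vert generalizing x with
  | zero =>
    have hx : x.vert = o := (hT.connected.dist_eq_zero_iff.1 hn).symm
    rw [IntegrableOn,
      Measure.restrict_eq_zero.2 (lengthMeasure_segment_of_vert_eq_root hT.connected hx)]
    exact integrable_zero_measure
  | succ n ih =>
    have hx : x.vert ≠ o := ne_root_of_dist hn
    rw [segment_eq_union hT hx]
    refine (ih _ ?_).union (integrableOn_edgeDeriv_lastEdge hT.connected a hx)
    exact Nat.succ.inj ((parent_spec hT.connected hx).2.symm.trans hn)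

theorem setIntegral_edgeDeriv_segment (hT : G.IsTree) (a : V → ℝ) (x : Point G o) :
    ∫ z in segment x, edgeDeriv a z ∂lengthMeasure G o = edgeExtension a x - a o := by
  induction hn : G.dist o x.vert generalizing x with
  | zero =>
    have hx : x.vert = o := (hT.connected.dist_eq_zero_iff.1 hn).symm
    rw [setIntegral_measure_zero _ (lengthMeasure_segment_of_vert_eq_root hT.connected hx),
      edgeExtension, hx, parent_root, AffineMap.lineMap_same_apply, sub_self]
  | succ n ih =>
    have hx : x.vert ≠ o := ne_root_of_dist hn
    have hd : G.dist o (parent G o x.vert) = n :=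
      Nat.succ.inj ((parent_spec hT.connected hx).2.symm.trans hn)
    rw [segment_eq_union hT hx, setIntegral_union (disjoint_segment_lastEdge hT.connected hx)
      (measurableSet_lastEdge x) (integrableOn_edgeDeriv_segment hT a _)
      (integrableOn_edgeDeriv_lastEdge hT.connected a hx), ih _ hd,
      setIntegral_edgeDeriv_lastEdge hT.connected a hx, edgeExtension_vertexPoint]
    ring

theorem isUpperGradient_edgeSlope (hT : G.IsTree) (a : V → ℝ) :
    IsUpperGradient (G := G) (o := o) ε (edgeExtension a) (edgeSlope ε a) := by
  refine ⟨measurable_edgeSlope a, fun x y => ?_⟩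
  have hx := integral_inter_add_sdiff (measurableSet_segment y)
    (integrableOn_edgeDeriv_segment hT a x)
  have hy := integral_inter_add_sdiff (measurableSet_segment x)
    (integrableOn_edgeDeriv_segment hT a y)
  rw [setIntegral_edgeDeriv_segment hT] at hx hy
  rw [inter_comm] at hy
  have hdiff : edgeExtension a x - edgeExtension a y =
      ∫ z in segment x \ segment y, edgeDeriv a z ∂lengthMeasure G o -
        ∫ z in segment y \ segment x, edgeDeriv a z ∂lengthMeasure G o := by linarith
  have hle (S : Set (Point G o)) : ‖∫ z in S, edgeDeriv a z ∂lengthMeasure G o‖ₑ ≤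
      ∫⁻ z in S, edgeSlope ε a z * ENNReal.ofReal (Real.exp (-ε * z.height))
        ∂lengthMeasure G o := by
    simpa only [enorm_edgeDeriv ε] using
      enorm_integral_le_lintegral_enorm (μ := (lengthMeasure G o).restrict S) (edgeDeriv a)
  rw [← Real.enorm_eq_ofReal_abs, hdiff]
  refine enorm_sub_le.trans ((add_le_add (hle _) (hle _)).trans ?_)
  rw [← lintegral_union ((measurableSet_segment y).diff (measurableSet_segment x))
    disjoint_sdiff_sdiff]
  refine lintegral_mono_set (union_subset (sdiff_segment_subset_geodesic hT x y) ?_)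
  rw [geodesic_comm]
  exact sdiff_segment_subset_geodesic hT y x

theorem Point.sub_mem_Icc (x : Point G o) :
    x.height - (G.dist o x.vert - 1) ∈ Icc (0 : ℝ) 1 :=
  ⟨by linarith [x.lt_height], by linarith [x.height_le]⟩

theorem edist_edgeExtension_le (a : V → ℝ) (x : Point G o) :
    edist (a (parent G o x.vert)) (edgeExtension a x) ≤
      edist (a x.vert) (a (parent G o x.vert)) := by
  rw [edist_comm (a x.vert), edist_dist, edist_dist, edgeExtension, dist_left_lineMap,
    Real.norm_of_nonneg x.sub_mem_Icc.1]
  exact ENNReal.ofReal_le_ofReal (mul_le_of_le_one_left dist_nonneg x.sub_mem_Icc.2)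

theorem enorm_edgeExtension_le (a : V → ℝ) (x : Point G o) :
    ‖edgeExtension a x‖ₑ ≤ ‖a x.vert‖ₑ + ‖a (parent G o x.vert)‖ₑ := by
  obtain ⟨h0, h1⟩ := x.sub_mem_Icc
  simp only [← ofReal_norm]
  rw [← ENNReal.ofReal_add (norm_nonneg _) (norm_nonneg _), edgeExtension,
    AffineMap.lineMap_apply_ring, add_comm ‖a x.vert‖]
  refine ENNReal.ofReal_le_ofReal ((norm_add_le _ _).trans (add_le_add ?_ ?_)) <;>
    rw [norm_mul] <;> refine mul_le_of_le_one_left (norm_nonneg _) ?_ <;>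
    rw [Real.norm_of_nonneg] <;> linarith

theorem edgeIntegral_le_of_le (hG : G.Connected) {β : ℝ} (hβ : 0 ≤ β) {v : V} {n : ℕ}
    (hv : G.dist o v = n + 1) {F : Point G o → ℝ≥0∞} {c : ℝ≥0∞}
    (h : ∀ z : Point G o, z.vert = v → F z ≤ c) :
    edgeIntegral β F v ≤ c * ENNReal.ofReal (Real.exp (-β * n)) := by
  have := isProbabilityMeasure_restrict_edgeHeights (G := G) (o := o) v
  calc edgeIntegral β F v
      ≤ ∫⁻ _ in edgeHeights G o v, c * ENNReal.ofReal (Real.exp (-β * n)) := by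
        refine setLIntegral_mono measurable_const fun t ht => ?_
        refine mul_le_mul' (h _ (edgePoint_spec hG (ne_root_of_dist hv) ht).1) ?_
        rw [edgeHeights, hv, Nat.cast_add_one, add_sub_cancel_right] at ht
        refine ENNReal.ofReal_le_ofReal (Real.exp_le_exp.2 ?_)
        exact mul_le_mul_of_nonpos_left ht.1.le (neg_nonpos.2 hβ)
    _ = _ := by rw [lintegral_const, measure_univ, mul_one]

theorem edgeIntegral_edgeSlope_rpow_le (hG : G.Connected) (hε : 0 ≤ ε) {β p : ℝ} (hβ : 0 ≤ β)
    (hp : 0 ≤ p) (a : V → ℝ) {v : V} {n : ℕ} (hv : G.dist o v = n + 1) :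
    edgeIntegral β (fun z : Point G o => edgeSlope ε a z ^ p) v ≤
      ENNReal.ofReal (Real.exp (p * ε * (n + 1) - β * n)) *
        edist (a v) (a (parent G o v)) ^ p := by
  refine (edgeIntegral_le_of_le hG hβ hv (c := edist (a v) (a (parent G o v)) ^ p *
    ENNReal.ofReal (Real.exp (p * ε * (n + 1)))) fun z hz => ?_).trans_eq ?_
  · have hheight := z.height_le
    rw [hz, hv, Nat.cast_add_one] at hheight
    rw [edgeSlope, hz, ENNReal.mul_rpow_of_nonneg _ _ hp,
      ENNReal.ofReal_rpow_of_pos (Real.exp_pos _), ← Real.exp_mul]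
    refine mul_le_mul_right (ENNReal.ofReal_le_ofReal (Real.exp_le_exp.2 ?_)) _
    rw [mul_right_comm, mul_comm ε p]
    exact mul_le_mul_of_nonneg_left hheight (mul_nonneg hp hε)
  · rw [mul_assoc, ← ENNReal.ofReal_mul (Real.exp_pos _).le, ← Real.exp_add, mul_comm, neg_mul,
      ← sub_eq_add_neg]

theorem edgeIntegral_edgeExtension_rpow_le (hG : G.Connected) {β p : ℝ} (hβ : 0 ≤ β)
    (hp : 1 ≤ p) (a : V → ℝ) {v : V} {n : ℕ} (hv : G.dist o v = n + 1) :
    edgeIntegral β (fun z : Point G o => ENNReal.ofReal |edgeExtension a z| ^ p) v ≤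
      ENNReal.ofReal (Real.exp (-β * n)) * 2 ^ (p - 1) *
        (‖a v‖ₑ ^ p + ‖a (parent G o v)‖ₑ ^ p) := by
  refine (edgeIntegral_le_of_le hG hβ hv (c := 2 ^ (p - 1) *
    (‖a v‖ₑ ^ p + ‖a (parent G o v)‖ₑ ^ p)) fun z hz => ?_).trans_eq (by ring)
  subst hz
  rw [← Real.enorm_eq_ofReal_abs]
  exact (ENNReal.rpow_le_rpow (enorm_edgeExtension_le a z) (by linarith)).trans
    (ENNReal.rpow_add_le_mul_rpow_add_rpow _ _ hp)

variable {K : ℕ} [hε : Fact (0 < ε)] {β p : ℝ}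

theorem IsKaryTree.lintegral_edgeSlope_rpow_le (hK : 2 ≤ K) (hG : IsKaryTree G o K) {θ : ℝ}
    (hβ : 0 ≤ β) (hp : 0 ≤ p) (hθ : θ * p * ε = p * ε - (β - Real.log K)) (a : V → ℝ) :
    ∫⁻ z : Point G o, edgeSlope ε a z ^ p ∂treeMeasure G o β ≤
      ENNReal.ofReal (Real.exp (p * ε + Real.log K)) *
        ∑' n : ℕ, ENNReal.ofReal (Real.exp (θ * p * ε * n)) *
          ∫⁻ ζ : Boundary G o ε, edist (a (ζ.vertex (n + 1))) (a (ζ.vertex n)) ^ p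
            ∂boundaryMeasure G o K ε := by
  rw [hG.lintegral_treeMeasure (ε := ε) hK β ((measurable_edgeSlope a).pow_const p),
    ← ENNReal.tsum_mul_left]
  refine ENNReal.tsum_le_tsum fun n => ?_
  calc (K : ℝ≥0∞) ^ (n + 1) * ∫⁻ ζ : Boundary G o ε,
        edgeIntegral β (fun z : Point G o => edgeSlope ε a z ^ p) (ζ.vertex (n + 1))
          ∂boundaryMeasure G o K ε
      ≤ (K : ℝ≥0∞) ^ (n + 1) * ∫⁻ ζ : Boundary G o ε,
          ENNReal.ofReal (Real.exp (p * ε * (n + 1) - β * n)) *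
            edist (a (ζ.vertex (n + 1))) (a (ζ.vertex n)) ^ p ∂boundaryMeasure G o K ε := by
        gcongr with ζ
        simpa only [ζ.parent_vertex hG.isTree] using edgeIntegral_edgeSlope_rpow_le hG.connected
          hε.out.le hβ hp a (ζ.dist_vertex (n + 1))
    _ = _ := by
        rw [lintegral_const_mul' _ _ ENNReal.ofReal_ne_top, ← mul_assoc, ← mul_assoc,
          ← ofReal_exp_natCast_mul_log (by omega), ← ENNReal.ofReal_mul (Real.exp_pos _).le,
          ← ENNReal.ofReal_mul (Real.exp_pos _).le, ← Real.exp_add, ← Real.exp_add, hθ]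
        congr 3
        push_cast
        ring

theorem IsKaryTree.lintegral_edgeExtension_rpow_le (hK : 2 ≤ K) (hG : IsKaryTree G o K)
    (hβ : 0 ≤ β) (hp : 1 ≤ p) (a : V → ℝ) {U : ℝ≥0∞}
    (hU : ∀ n, ∫⁻ ζ : Boundary G o ε, ‖a (ζ.vertex n)‖ₑ ^ p ∂boundaryMeasure G o K ε ≤ U) :
    ∫⁻ z : Point G o, ENNReal.ofReal |edgeExtension a z| ^ p ∂treeMeasure G o β ≤
      2 ^ p * K * (∑' n : ℕ, ENNReal.ofReal (Real.exp (-(β - Real.log K))) ^ n) * U := by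
  have := hG.countable
  have hm : Measurable fun z : Point G o => ENNReal.ofReal |edgeExtension a z| ^ p :=
    (measurable_edgeExtension a).abs.ennreal_ofReal.pow_const p
  rw [hG.lintegral_treeMeasure (ε := ε) hK β hm, ← ENNReal.tsum_mul_left, ← ENNReal.tsum_mul_right]
  refine ENNReal.tsum_le_tsum fun n => ?_
  have hlevel : ∫⁻ ζ : Boundary G o ε, edgeIntegral β
      (fun z : Point G o => ENNReal.ofReal |edgeExtension a z| ^ p) (ζ.vertex (n + 1))
        ∂boundaryMeasure G o K ε ≤
      ENNReal.ofReal (Real.exp (-β * n)) * 2 ^ (p - 1) * (U + U) := by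
    calc _ ≤ ∫⁻ ζ : Boundary G o ε, ENNReal.ofReal (Real.exp (-β * n)) * 2 ^ (p - 1) *
          (‖a (ζ.vertex (n + 1))‖ₑ ^ p + ‖a (ζ.vertex n)‖ₑ ^ p) ∂boundaryMeasure G o K ε := by
          gcongr with ζ
          simpa only [ζ.parent_vertex hG.isTree] using
            edgeIntegral_edgeExtension_rpow_le hG.connected hβ hp a (ζ.dist_vertex (n + 1))
      _ ≤ _ := by
          rw [lintegral_const_mul' _ _ (ENNReal.mul_ne_top ENNReal.ofReal_ne_top
              (ENNReal.rpow_ne_top_of_nonneg (by linarith) (by simp))), lintegral_add_left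
            (measurable_comp_vertex hG.isTree (fun v => ‖a v‖ₑ ^ p) (n + 1))]
          gcongr
          exacts [hU _, hU _]
  refine (mul_le_mul_right hlevel _).trans_eq ?_
  have hweight : ENNReal.ofReal (Real.exp (-(β - Real.log K))) ^ n =
      ENNReal.ofReal (Real.exp (-β * n)) * K ^ n := by
    rw [← ofReal_exp_natCast_mul_log (by omega), ← ENNReal.ofReal_mul (Real.exp_pos _).le,
      ← Real.exp_add, ← ENNReal.ofReal_pow (Real.exp_pos _).le, ← Real.exp_nat_mul]
    ring_nf
  rw [hweight, ← rpow_sub_one_mul_self hp]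
  ring

end Extension

/-! ### Averages over cylinders -/

section Averages

variable {V : Type*} {G : SimpleGraph V} {o : V} {K : ℕ} {ε p : ℝ} [hε : Fact (0 < ε)]
  {u : Boundary G o ε → ℝ}

/-- The average of `u` over the cylinder of `v`, the value at `v` of the extension of `u`. -/
def cylinderAverage (K : ℕ) (u : Boundary G o ε → ℝ) (v : V) : ℝ :=
  ⨍ ζ in cylinder ε v, u ζ ∂boundaryMeasure G o K ε

theorem IsKaryTree.lintegral_cylinderAverage_rpow_le (hK : 2 ≤ K) (hG : IsKaryTree G o K)
    (hp : 1 ≤ p) (hu : AEStronglyMeasurable u (boundaryMeasure G o K ε)) (n : ℕ) :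
    ∫⁻ ζ : Boundary G o ε, ‖cylinderAverage K u (ζ.vertex n)‖ₑ ^ p ∂boundaryMeasure G o K ε ≤
      ∫⁻ ζ, ‖u ζ‖ₑ ^ p ∂boundaryMeasure G o K ε := by
  have := hG.isProbabilityMeasure_boundaryMeasure (ε := ε) hK
  rw [← hG.lintegral_laverage_cylinder hK n fun ζ => ‖u ζ‖ₑ ^ p]
  refine lintegral_mono fun ζ => ?_
  have := hG.neZero_restrict_cylinder (ε := ε) hK (ζ.vertex n)
  exact enorm_average_rpow_le hp hu.restrict

theorem IsKaryTree.lintegral_edist_cylinderAverage_le (hK : 2 ≤ K) (hG : IsKaryTree G o K)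
    (hp : 1 ≤ p) (hu : Integrable u (boundaryMeasure G o K ε)) (n : ℕ) :
    ∫⁻ ζ : Boundary G o ε, edist (u ζ) (cylinderAverage K u (ζ.vertex n)) ^ p
      ∂boundaryMeasure G o K ε ≤ cylinderOsc K p u n := by
  have := hG.isProbabilityMeasure_boundaryMeasure (ε := ε) hK
  simp only [cylinderOsc, ofReal_abs_sub_eq_edist]
  refine lintegral_mono fun ζ => ?_
  have := hG.neZero_restrict_cylinder (ε := ε) hK (ζ.vertex n)
  exact edist_average_rpow_le hp hu.restrict (u ζ)

theorem IsKaryTree.aemeasurable_edist_cylinderAverage (hG : IsKaryTree G o K)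
    (hu : AEMeasurable u (boundaryMeasure G o K ε)) (n : ℕ) :
    AEMeasurable (fun ζ : Boundary G o ε => edist (u ζ) (cylinderAverage K u (ζ.vertex n)) ^ p)
      (boundaryMeasure G o K ε) :=
  have := hG.countable
  (hu.edist (measurable_comp_vertex hG.isTree (cylinderAverage K u) n).aemeasurable).pow_const p

theorem IsKaryTree.ae_tendsto_cylinderAverage (hK : 2 ≤ K) (hG : IsKaryTree G o K)
    (hp : 1 ≤ p) (hu : Integrable u (boundaryMeasure G o K ε))
    (hosc : ∑' n, cylinderOsc K p u n ≠ ∞) :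
    ∀ᵐ ζ ∂boundaryMeasure G o K ε,
      Tendsto (fun n => cylinderAverage K u (ζ.vertex n)) atTop (𝓝 (u ζ)) :=
  ae_tendsto_of_tsum_lintegral_edist_rpow_ne_top (by linarith)
    (hG.aemeasurable_edist_cylinderAverage (p := p) hu.aestronglyMeasurable.aemeasurable)
    (ne_top_of_le_ne_top hosc
      (ENNReal.tsum_le_tsum fun n => hG.lintegral_edist_cylinderAverage_le hK hp hu n))

theorem isTrace_edgeExtension (hT : G.IsTree) {a : V → ℝ}
    (h : ∀ᵐ ζ ∂boundaryMeasure G o K ε, Tendsto (fun n => a (ζ.vertex n)) atTop (𝓝 (u ζ))) :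
    IsTrace K (edgeExtension a : Point G o → ℝ) u := by
  filter_upwards [h] with ζ hζ
  refine tendsto_ray_of_tendsto_vertexPoint
    (d := fun n => edist (a (ζ.vertex (n + 1))) (a (ζ.vertex n))) ?_ (fun n t ht => ?_)
    (by simpa only [edgeExtension_vertexPoint] using hζ)
  · simpa only [edist_self, Function.comp_def] using (hζ.comp (tendsto_add_atTop_nat 1)).edist hζ
  · have hv : (ζ.ray t).vert = ζ.vertex (n + 1) := by simp only [Boundary.ray, ht]
    simpa only [edgeExtension_vertexPoint, hv, ζ.parent_vertex hT] using
      edist_edgeExtension_le a (ζ.ray t)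

theorem IsKaryTree.lintegral_edist_cylinderAverage_succ_le (hK : 2 ≤ K) (hG : IsKaryTree G o K)
    (hp : 1 ≤ p) (hu : Integrable u (boundaryMeasure G o K ε)) (n : ℕ) :
    ∫⁻ ζ : Boundary G o ε, edist (cylinderAverage K u (ζ.vertex (n + 1)))
      (cylinderAverage K u (ζ.vertex n)) ^ p ∂boundaryMeasure G o K ε ≤
      2 ^ (p - 1) * (cylinderOsc K p u (n + 1) + cylinderOsc K p u n) :=
  calc _ ≤ ∫⁻ ζ : Boundary G o ε, 2 ^ (p - 1) *
        (edist (u ζ) (cylinderAverage K u (ζ.vertex (n + 1))) ^ p +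
          edist (u ζ) (cylinderAverage K u (ζ.vertex n)) ^ p) ∂boundaryMeasure G o K ε := by
        refine lintegral_mono fun ζ => (ENNReal.rpow_le_rpow ?_ (by linarith)).trans
          (ENNReal.rpow_add_le_mul_rpow_add_rpow _ _ hp)
        exact edist_triangle_left _ _ _
    _ ≤ _ := by
        rw [lintegral_const_mul' _ _ (ENNReal.rpow_ne_top_of_nonneg (by linarith) (by simp)),
          lintegral_add_left' (hG.aemeasurable_edist_cylinderAverage
            hu.aestronglyMeasurable.aemeasurable (n + 1))]
        gcongr <;> exact hG.lintegral_edist_cylinderAverage_le hK hp hu _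

theorem IsKaryTree.lintegral_edgeSlope_cylinderAverage_le (hK : 2 ≤ K) (hG : IsKaryTree G o K)
    {β θ : ℝ} (hβ : 0 ≤ β) (hp : 1 ≤ p) (hθ : θ * p * ε = p * ε - (β - Real.log K))
    (hθ0 : 0 ≤ θ) (hu : Integrable u (boundaryMeasure G o K ε)) :
    ∫⁻ z : Point G o, edgeSlope ε (cylinderAverage K u) z ^ p ∂treeMeasure G o β ≤
      ENNReal.ofReal (Real.exp (p * ε + Real.log K)) * 2 ^ p * discreteBesovEnergy K θ p u := by
  refine (hG.lintegral_edgeSlope_rpow_le hK hβ (by linarith) hθ _).trans ?_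
  rw [mul_assoc (ENNReal.ofReal _)]
  refine mul_le_mul_right ?_ _
  have hε0 := hε.out
  let w (n : ℕ) : ℝ≥0∞ := ENNReal.ofReal (Real.exp (θ * p * ε * n)) * cylinderOsc K p u n
  have hlevel (n : ℕ) : ENNReal.ofReal (Real.exp (θ * p * ε * n)) *
      ∫⁻ ζ : Boundary G o ε, edist (cylinderAverage K u (ζ.vertex (n + 1)))
        (cylinderAverage K u (ζ.vertex n)) ^ p ∂boundaryMeasure G o K ε ≤
      2 ^ (p - 1) * (w (n + 1) + w n) := by
    refine (mul_le_mul_right (hG.lintegral_edist_cylinderAverage_succ_le hK hp hu n) _).trans ?_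
    rw [mul_left_comm, mul_add]
    dsimp only [w]
    gcongr
    exact n.le_succ
  calc _ ≤ 2 ^ (p - 1) * ((∑' n, w (n + 1)) + ∑' n, w n) := by
        rw [← ENNReal.tsum_add, ← ENNReal.tsum_mul_left]
        exact ENNReal.tsum_le_tsum hlevel
    _ ≤ 2 ^ (p - 1) * ((∑' n, w n) + ∑' n, w n) := by
        refine mul_le_mul_right (add_le_add_left ?_ _) _
        exact ENNReal.tsum_comp_le_tsum_of_injective (add_left_injective 1) w
    _ = 2 ^ p * discreteBesovEnergy K θ p u := by
        rw [← two_mul, ← mul_assoc, rpow_sub_one_mul_self hp, discreteBesovEnergy]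

end Averages

/-! ### Equivalence of the norms -/

section Norms

variable {V : Type*} {G : SimpleGraph V} {o : V} {K : ℕ} {ε β p θ : ℝ} {f : Point G o → ℝ}

theorem le_rpow_inv_mul_of_rpow_le (hp : 0 < p) {a b C : ℝ≥0∞} (h : a ^ p ≤ C * b ^ p) :
    a ≤ C ^ p⁻¹ * b := by
  have hroot := ENNReal.rpow_le_rpow h (inv_pos.2 hp).le
  rwa [ENNReal.mul_rpow_of_nonneg _ _ (inv_pos.2 hp).le, ENNReal.rpow_rpow_inv hp.ne',
    ENNReal.rpow_rpow_inv hp.ne'] at hroot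

theorem newtonNorm_rpow (ε β : ℝ) (hp : p ≠ 0) (f : Point G o → ℝ) :
    newtonNorm ε β p f ^ p =
      ⨅ (g : Point G o → ℝ≥0∞) (_ : IsUpperGradient ε f g), newtonEnergy β p f g := by
  rw [newtonNorm, one_div, ENNReal.rpow_inv_rpow hp, ENNReal.add_iInf₂]
  rfl

theorem exists_isUpperGradient_newtonEnergy_lt_top (hp : 0 < p) (hf : newtonNorm ε β p f < ∞) :
    ∃ g, IsUpperGradient ε f g ∧ newtonEnergy β p f g < ∞ := by
  have hlt := ENNReal.rpow_lt_top_of_nonneg hp.le hf.ne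
  rw [newtonNorm_rpow ε β hp.ne'] at hlt
  simpa only [iInf_lt_iff, exists_prop] using hlt

theorem le_mul_newtonNorm (hp : 0 < p) {X : ℝ≥0∞} {C : ℝ≥0} (hC : C ≠ 0)
    (h : ∀ g, IsUpperGradient ε f g → X ^ p ≤ C * newtonEnergy β p f g) :
    X ≤ C ^ p⁻¹ * newtonNorm ε β p f := by
  refine le_rpow_inv_mul_of_rpow_le hp ?_
  simp only [newtonNorm_rpow ε β hp.ne',
    ENNReal.mul_iInf_of_ne (ENNReal.coe_ne_zero.2 hC) ENNReal.coe_ne_top]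
  exact le_iInf₂ h

variable [hε : Fact (0 < ε)] {u : Boundary G o ε → ℝ}

theorem le_mul_traceNorm {X : ℝ≥0∞} {C : ℝ≥0} (hC : C ≠ 0)
    (h : ∀ f, IsTrace K f u → X ≤ C * newtonNorm ε β p f) : X ≤ C * traceNorm K β p u := by
  simp only [traceNorm, ENNReal.mul_iInf_of_ne (ENNReal.coe_ne_zero.2 hC) ENNReal.coe_ne_top]
  exact le_iInf₂ fun f hf => h f hf.2

theorem eLpNorm_ofReal_rpow {Ω E : Type*} [MeasurableSpace Ω] [NormedAddCommGroup E]
    {μ : Measure Ω} (hp : 0 < p) (u : Ω → E) :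
    eLpNorm u (ENNReal.ofReal p) μ ^ p = ∫⁻ x, ‖u x‖ₑ ^ p ∂μ := by
  lift p to ℝ≥0 using hp.le
  rw [ENNReal.ofReal_coe_nnreal]
  exact eLpNorm_nnreal_pow_eq_lintegral (NNReal.coe_pos.1 hp).ne'

theorem mem_besovSpace_iff : u ∈ besovSpace G o K ε θ p p ↔
    AEStronglyMeasurable u (boundaryMeasure G o K ε) ∧ besovNorm K θ p p u < ∞ := by
  rw [besovNorm, ENNReal.add_lt_top, ← and_assoc]
  rfl

theorem IsKaryTree.exists_besovNorm_trace_le (hK : 2 ≤ K) (hG : IsKaryTree G o K)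
    (hβ : 0 ≤ β) (hp : 1 ≤ p) (hθ : θ * p * ε = p * ε - (β - Real.log K)) (hθ0 : 0 < θ) :
    ∃ C : ℝ≥0, C ≠ 0 ∧ ∀ (f : Point G o → ℝ) (u : Boundary G o ε → ℝ), IsTrace K f u →
      besovNorm K θ p p u ≤ C * newtonNorm ε β p f := by
  have hp0 : 0 < p := by linarith
  obtain ⟨C₁, hC₁⟩ := hG.exists_lintegral_trace_rpow_le (ε := ε) hK hβ hp hθ hθ0
  obtain ⟨C₂, hC₂⟩ := hG.exists_discreteBesovEnergy_trace_le (ε := ε) hK hβ hp hθ hθ0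
  let c : ℝ≥0 := ((2 / ε) ^ (-(θ * p)) / (θ * p)).toNNReal
  refine ⟨(C₁ + 1) ^ p⁻¹ + (c * C₂ + 1) ^ p⁻¹, by positivity, fun f u hu => ?_⟩
  rw [ENNReal.coe_add, add_mul, ENNReal.coe_rpow_of_nonneg _ (by positivity),
    ENNReal.coe_rpow_of_nonneg _ (by positivity), besovNorm]
  refine add_le_add (le_mul_newtonNorm hp0 (by positivity) fun g hg => ?_)
    (le_mul_newtonNorm hp0 (by positivity) fun g hg => ?_)
  · rw [eLpNorm_ofReal_rpow hp0]
    exact (hC₁ f g u hg hu).trans (by gcongr; exact le_self_add)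
  · calc besovSeminorm K θ p p u ^ p
        ≤ c * discreteBesovEnergy K θ p u := besovSeminorm_rpow_le hG.isTree hp0 hθ0 u
      _ ≤ c * (C₂ * newtonEnergy β p f g) := by
          gcongr
          exact (hC₂ f g u hg hu).trans (mul_le_mul_right le_add_self _)
      _ ≤ (c * C₂ + 1 : ℝ≥0) * newtonEnergy β p f g := by
          rw [← mul_assoc, ← ENNReal.coe_mul]
          gcongr
          exact le_self_add

theorem exists_discreteBesovEnergy_le (hT : G.IsTree) (hp : 0 < p) (hθ : 0 < θ) :
    ∃ C : ℝ≥0, ∀ u : Boundary G o ε → ℝ,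
      discreteBesovEnergy K θ p u ≤ C * besovSeminorm K θ p p u ^ p := by
  let c := (2 / ε) ^ (-(θ * p)) / (θ * p) * (1 - Real.exp (-(θ * p * ε)))
  have hc : 0 < c := by
    have hε0 := hε.out
    have hexp : 0 < 1 - Real.exp (-(θ * p * ε)) :=
      sub_pos.2 (Real.exp_lt_one_iff.2 (neg_lt_zero.2 (by positivity)))
    positivity
  refine ⟨c⁻¹.toNNReal, fun u => ?_⟩
  change _ ≤ ENNReal.ofReal c⁻¹ * _
  rw [ENNReal.ofReal_inv_of_pos hc, mul_comm, ← div_eq_mul_inv,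
    ENNReal.le_div_iff_mul_le (.inl (ENNReal.ofReal_pos.2 hc).ne') (.inl ENNReal.ofReal_ne_top),
    mul_comm]
  exact discreteBesovEnergy_le hT hp hθ u

theorem tsum_cylinderOsc_le_discreteBesovEnergy (hp : 0 ≤ p) (hθ : 0 ≤ θ)
    (u : Boundary G o ε → ℝ) : ∑' n, cylinderOsc K p u n ≤ discreteBesovEnergy K θ p u := by
  have hε0 := hε.out
  refine ENNReal.tsum_le_tsum fun n => le_mul_of_one_le_left' ?_
  rw [ENNReal.one_le_ofReal, Real.one_le_exp_iff]
  positivity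

theorem IsKaryTree.isTrace_edgeExtension_cylinderAverage (hK : 2 ≤ K) (hG : IsKaryTree G o K)
    (hp : 1 ≤ p) (hθ : 0 < θ) (hu : Integrable u (boundaryMeasure G o K ε))
    (hus : besovSeminorm K θ p p u < ∞) :
    IsTrace K (edgeExtension (cylinderAverage K u) : Point G o → ℝ) u := by
  have hp0 : 0 < p := by linarith
  obtain ⟨C, hC⟩ := exists_discreteBesovEnergy_le (K := K) (o := o) (ε := ε) hG.isTree hp0 hθ
  refine isTrace_edgeExtension hG.isTree (hG.ae_tendsto_cylinderAverage hK hp hu ?_)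
  refine ne_top_of_le_ne_top ?_
    ((tsum_cylinderOsc_le_discreteBesovEnergy hp0.le hθ.le u).trans (hC u))
  exact ENNReal.mul_ne_top ENNReal.coe_ne_top (ENNReal.rpow_ne_top_of_nonneg hp0.le hus.ne)

theorem IsKaryTree.exists_newtonEnergy_cylinderAverage_le (hK : 2 ≤ K) (hG : IsKaryTree G o K)
    (hβ : Real.log K < β) (hp : 1 ≤ p) (hθ : θ * p * ε = p * ε - (β - Real.log K)) (hθ0 : 0 < θ) :
    ∃ C : ℝ≥0, ∀ u : Boundary G o ε → ℝ, Integrable u (boundaryMeasure G o K ε) →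
      newtonEnergy (G := G) (o := o) β p (edgeExtension (cylinderAverage K u))
        (edgeSlope ε (cylinderAverage K u)) ≤ C * besovNorm K θ p p u ^ p := by
  have hp0 : 0 < p := by linarith
  have hβ0 : 0 ≤ β := (Real.log_natCast_nonneg K).trans hβ.le
  have hpow : (2 : ℝ≥0∞) ^ p ≠ ∞ := ENNReal.rpow_ne_top_of_nonneg hp0.le (by simp)
  have hsum := tsum_ofReal_exp_neg_pow_ne_top (sub_pos.2 hβ)
  obtain ⟨C, hC⟩ := exists_discreteBesovEnergy_le (K := K) (o := o) (ε := ε) hG.isTree hp0 hθ0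
  refine ⟨(2 ^ p * K * (∑' n : ℕ, ENNReal.ofReal (Real.exp (-(β - Real.log K))) ^ n) +
    ENNReal.ofReal (Real.exp (p * ε + Real.log K)) * 2 ^ p * C : ℝ≥0∞).toNNReal, fun u hu => ?_⟩
  rw [ENNReal.coe_toNNReal (by finiteness), add_mul]
  refine add_le_add ?_ ?_
  · refine (hG.lintegral_edgeExtension_rpow_le hK hβ0 hp _
      (hG.lintegral_cylinderAverage_rpow_le hK hp hu.aestronglyMeasurable)).trans ?_
    rw [← eLpNorm_ofReal_rpow hp0]
    gcongr
    exact le_self_add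
  · refine (hG.lintegral_edgeSlope_cylinderAverage_le hK hβ0 hp hθ hθ0.le hu).trans ?_
    rw [mul_assoc _ (C : ℝ≥0∞)]
    refine mul_le_mul_right ((hC u).trans ?_) _
    gcongr
    exact le_add_self

theorem IsKaryTree.exists_extension (hK : 2 ≤ K) (hG : IsKaryTree G o K)
    (hβ : Real.log K < β) (hp : 1 ≤ p) (hθ : θ * p * ε = p * ε - (β - Real.log K)) (hθ0 : 0 < θ) :
    ∃ C : ℝ≥0, ∀ u ∈ besovSpace G o K ε θ p p, ∃ f ∈ newtonSpace G o ε β p,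
      IsTrace K f u ∧ newtonNorm ε β p f ≤ C * besovNorm K θ p p u := by
  have hp0 : 0 < p := by linarith
  have := hG.isProbabilityMeasure_boundaryMeasure (ε := ε) hK
  obtain ⟨C, hC⟩ := hG.exists_newtonEnergy_cylinderAverage_le (ε := ε) hK hβ hp hθ hθ0
  refine ⟨C ^ p⁻¹, fun u hu => ?_⟩
  have hint := hu.1.integrable (ENNReal.one_le_ofReal.2 hp)
  have hle : newtonNorm ε β p (edgeExtension (cylinderAverage K u) : Point G o → ℝ) ≤
      (C ^ p⁻¹ : ℝ≥0) * besovNorm K θ p p u := by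
    rw [ENNReal.coe_rpow_of_nonneg _ (by positivity)]
    refine le_rpow_inv_mul_of_rpow_le hp0 ?_
    rw [newtonNorm_rpow ε β hp0.ne']
    exact (iInf₂_le _ (isUpperGradient_edgeSlope hG.isTree _)).trans (hC u hint)
  exact ⟨edgeExtension (cylinderAverage K u), ⟨(measurable_edgeExtension _).aemeasurable,
    hle.trans_lt (ENNReal.mul_lt_top ENNReal.coe_lt_top (mem_besovSpace_iff.1 hu).2)⟩,
    hG.isTrace_edgeExtension_cylinderAverage hK hp hθ0 hint hu.2, hle⟩

end Norms

end KTree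

end

theorem theorem6p4 {V : Type*} (G : SimpleGraph V) (o : V) (K : ℕ) (hK : 2 ≤ K)
    (hG : KTree.IsKaryTree G o K) (ε β p θ : ℝ) [Fact (0 < ε)] (hβ : Real.log K < β)
    (hp : 1 ≤ p) (hθ : θ = 1 - (β - Real.log K) / (p * ε)) (hθ_pos : 0 < θ) :
    (∀ f ∈ KTree.newtonSpace G o ε β p, ∃ u : KTree.Boundary G o ε → ℝ, KTree.IsTrace K f u) ∧
    KTree.traceSpace G o K ε β p = KTree.besovSpace G o K ε θ p p ∧
    ∃ C : ℝ≥0, ∀ u ∈ KTree.besovSpace G o K ε θ p p,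
      KTree.besovNorm K θ p p u ≤ C * KTree.traceNorm K β p u ∧
      KTree.traceNorm K β p u ≤ C * KTree.besovNorm K θ p p u := by
  have hε0 : 0 < ε := Fact.out
  have hp0 : 0 < p := by linarith
  have hβ0 : 0 ≤ β := (Real.log_natCast_nonneg K).trans hβ.le
  have hθ' : θ * p * ε = p * ε - (β - Real.log K) := by rw [hθ]; field_simp
  have := hG.countable
  obtain ⟨C₁, hC₁, htrace⟩ := hG.exists_besovNorm_trace_le hK hβ0 hp hθ' hθ_pos
  obtain ⟨C₂, hext⟩ := hG.exists_extension hK hβ hp hθ' hθ_pos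
  refine ⟨fun f hf => ?_, Subset.antisymm ?_ fun u hu => ?_, C₁ + C₂, fun u hu => ⟨?_, ?_⟩⟩
  · obtain ⟨g, hg, hfin⟩ := KTree.exists_isUpperGradient_newtonEnergy_lt_top hp0 hf.2
    exact hG.exists_isTrace hK hβ0 hp hθ' hθ_pos hg (ENNReal.add_lt_top.1 hfin).2.ne
  · rintro u ⟨f, hf, hu⟩
    exact KTree.mem_besovSpace_iff.2 ⟨(hu.aemeasurable hG.isTree).aestronglyMeasurable,
      (htrace f u hu).trans_lt (ENNReal.mul_lt_top ENNReal.coe_lt_top hf.2)⟩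
  · obtain ⟨f, hf, hfu, -⟩ := hext u hu
    exact ⟨f, hf, hfu⟩
  · exact (KTree.le_mul_traceNorm hC₁ fun f => htrace f u).trans (by gcongr; exact le_self_add)
  · obtain ⟨f, hf, hfu, hle⟩ := hext u hu
    exact (iInf₂_le f ⟨hf, hfu⟩).trans (hle.trans (by gcongr; exact le_add_self))
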